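/- **Theorem 2.** Let $k,l\ge 1$, $\sigma_a^2,\sigma_z^2>0$, and let $W\in\mathbb{R}^{k\times l}$ have no zero row (for instance, all $w_{i,j}\ne 0$). For $m\ge k$ let $n_m\ge 1$ be an integer, and let $\mathbf S=(S_1,\dots,S_k)$ be drawn uniformly from $[m]=\{1,\dots,m\}$ without replacement. Let $X=X(W,\mathbf S)\in\mathbb{R}^{m\times l}$ be the matrix whose row $S_j$ is row $j$ of $W$ for $j=1,\dots,k$ and whose other rows are zero, and let $\operatorname{supp}(X)$ be the set of indices of its nonzero rows. Let $Z\in\mathbb{R}^{n_m\times l}$ have i.i.d. $\mathcal N(0,\sigma_z^2)$ entries, independent of $\mathbf S$. Put $$c(W)=\min_{\emptyset\ne T\subseteq[k]}\ \frac{1}{2|T|}\log\det\Bigl(I+\frac{\sigma_a^2}{\sigma_z^2}W_T^{\top}W_T\Bigr),$$ where $W_T$ is the submatrix of the rows of $W$ indexed by $T$, and $\log$ is the natural logarithm. (a) *Gaussian measurements.* Let $A^{(m)}\in\mathbb{R}^{n_m\times m}$ have i.i.d. $\mathcal N(0,\sigma_a^2)$ entries, independent of $(\mathbf S,Z)$,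 and let $Y=A^{(m)}X+Z$. Let $d^{(m)}$, $m\ge k$, be any sequence of (measurable) support recovery maps, which assign to $Y$ and $A^{(m)}$ a subset of $[m]$, and let $P_m=\mathbb P\{d^{(m)}(A^{(m)},Y)\ne\operatorname{supp}(X)\}$, the probability being over $\mathbf S$, $A^{(m)}$ and $Z$. - If $\limsup_{m\to\infty}\frac{\log m}{n_m}>c(W)$, then $\limsup_{m\to\infty}P_m>0$, i.e. the error probability does not tend to $0$. - If $m_1<m_2<\cdots$ is any strictly increasing sequence with $\liminf_{j\to\infty}\frac{\log m_j}{n_{m_j}}>c(W)$, then $\liminf_{j\to\infty}P_{m_j}>0$. In particular, if $\liminf_{m\to\infty}\frac{\log m}{n_m}>c(W)$, then $\liminf_{m\to\infty}P_m>0$. (b) *Arbitrary measurements of bounded average power.* Let $A^{(m)}\in\mathbb{R}^{n_m\times m}$, $m\ge k$, be fixed matrices with $\frac{1}{n_m m}\|A^{(m)}\|_F^2\le\sigma_a^2$, and let $d^{(m)}:\mathbb{R}^{n_m\times l}\to 2^{[m]}$ be (measurable) support recovery maps. If $$\lim_{m\to\infty}\mathbb P\{d^{(m)}(A^{(m)}X+Z)\ne\operatorname{supp}(X)\}=0,$$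 the probability being over $\mathbf S$ and $Z$, then $$\limsup_{m\to\infty}\frac{\log m}{n_m}\le c(W).$$ -/

import Mathlib

open MeasureTheory ProbabilityTheory Filter Topology
open scoped NNReal Matrix

noncomputable section

namespace SupportRecovery

/-- Location vectors `(S₁, …, S_k) ∈ [m]^k` with distinct entries carry the discrete σ-algebra. -/
instance instMeasurableSpaceLocations (k m : ℕ) : MeasurableSpace (Fin k ↪ Fin m) := ⊤

/-- Matrices carry the product (Borel) σ-algebra of their entries. -/
instance instMeasurableSpaceMatrix (n q : ℕ) : MeasurableSpace (Matrix (Fin n) (Fin q) ℝ) :=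
  inferInstanceAs (MeasurableSpace (Fin n → Fin q → ℝ))

/-- The law of `(S₁, …, S_k)` drawn uniformly from `[m]` without replacement
(meaningful for `k ≤ m`). -/
def locationLaw (k m : ℕ) : Measure (Fin k ↪ Fin m) := uniformOn Set.univ

/-- The law of an `n × q` matrix with i.i.d. `N(0, v)` entries. -/
def gaussianMatrix (n q : ℕ) (v : ℝ≥0) : Measure (Matrix (Fin n) (Fin q) ℝ) :=
  Measure.pi fun _ : Fin n => Measure.pi fun _ : Fin q => gaussianReal 0 v

/-- The signal `X(W, S)`: row `S j` of `X` is row `j` of `W`, and the other rows are zero. -/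
def signal {k l m : ℕ} (W : Matrix (Fin k) (Fin l) ℝ) (S : Fin k ↪ Fin m) :
    Matrix (Fin m) (Fin l) ℝ :=
  fun s i => ∑ j : Fin k, if s = S j then W j i else 0

/-- The support of a matrix: the set of indices of its nonzero rows. -/
def supp {m l : ℕ} (X : Matrix (Fin m) (Fin l) ℝ) : Set (Fin m) :=
  {s | ∃ i, X s i ≠ 0}

/-- `c(W)`: the minimum, over the nonempty `T ⊆ [k]`, of
`(1 / (2|T|)) log det (I + (σ_a² / σ_z²) W_Tᵀ W_T)`, where `W_T` consists of the rows of `W`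
indexed by `T`; here `va = σ_a²` and `vz = σ_z²`. -/
def capacity {k l : ℕ} (va vz : ℝ≥0) (W : Matrix (Fin k) (Fin l) ℝ) : ℝ :=
  ⨅ T : {T : Finset (Fin k) // T.Nonempty},
    1 / (2 * (T.1.card : ℝ)) *
      Real.log (1 + ((va : ℝ) / (vz : ℝ)) •
        ((W.submatrix (fun i : T.1 => (i : Fin k)) id)ᵀ *
          W.submatrix (fun i : T.1 => (i : Fin k)) id)).det

/-- The average power `‖A‖_F² / (n m)` of an `n × m` matrix. -/
def avgPower {n m : ℕ} (A : Matrix (Fin n) (Fin m) ℝ) : ℝ :=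
  (∑ i, ∑ p, A i p ^ 2) / ((n : ℝ) * (m : ℝ))

/-- `P{d(A X + Z) ≠ supp X}` for a fixed measurement matrix `A`, over the randomness of the
independent `S` and `Z`. -/
def errorProbFixed {k l n m : ℕ} (vz : ℝ≥0) (W : Matrix (Fin k) (Fin l) ℝ)
    (A : Matrix (Fin n) (Fin m) ℝ) (d : Matrix (Fin n) (Fin l) ℝ → Set (Fin m)) : ℝ :=
  ((locationLaw k m).prod (gaussianMatrix n l vz)).real
    {ω | d (A * signal W ω.1 + ω.2) ≠ supp (signal W ω.1)}

/-- `P{d(A, A X + Z) ≠ supp X}` for a Gaussian measurement matrix `A`, over the randomness of the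
independent `S`, `A` and `Z`. The recovery map may use the realization of `A`. -/
def errorProbGaussian {k l n m : ℕ} (va vz : ℝ≥0) (W : Matrix (Fin k) (Fin l) ℝ)
    (d : Matrix (Fin n) (Fin m) ℝ → Matrix (Fin n) (Fin l) ℝ → Set (Fin m)) : ℝ :=
  ((locationLaw k m).prod ((gaussianMatrix n m va).prod (gaussianMatrix n l vz))).real
    {ω | d ω.2.1 (ω.2.1 * signal W ω.1 + ω.2.2) ≠ supp (signal W ω.1)}

/-- The rate `(log m) / n_m`, as an extended real (its upper limit may be `+∞`). -/
def rate (n : ℕ → ℕ) (m : ℕ) : EReal := ((Real.log (m : ℝ) / (n m : ℝ) : ℝ) : EReal)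

end SupportRecovery

end

/-! The argument is a Fano-type converse by change of measure, with a genie revealing the locations
outside a set `T`. Let `T` attain the minimum in `c(W)`, let `t = |T|` and `K = I + (σ_a²/σ_z²) W_Tᵀ
W_T`. Given `S`, the law `P_S` of the observation is white Gaussian noise around `A X`. It is
compared with a Gaussian law `Q_S` whose rows have covariance `σ_z² K` and whose mean `genieMean`
depends on `S` only through the locations outside `T`. For every event `E` and real `c`, `c P_S(E) ≤
D(P_S ‖ Q_S) + e^c Q_S(E)` (`mul_setIntegral_le_divergence_add`).

Take for `E` the event of correct recovery. Since `Q_S` ignores the entries in `T`, a double count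
(`pow_mul_sum_range_eq_le`) bounds the average of `Q_S(E)` over `S` by `k^k / (m-k+1)^t`. Choosing
`e^c` as the reciprocal makes the last term at most `1`.

Each row contributes `½ log det K - (l - tr K⁻¹)/2` to the divergence, plus a quadratic term in the
difference of the means. The variance bound for sampling without replacement (`sum_embedding_sq_le`)
shows that, under the power constraint, the average quadratic term offsets the trace term up to a
relative error of order `1/m`. Hence, with `τ = (l - tr K⁻¹)/2` and `P` the error probability, `(1 -
P) log((m-k+1)^t / k^k) ≤ 1 + n t c(W) + τ n/(m-1)`. The logarithm on the left is `t log m + O(1)`,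
so a rate above `c(W)` keeps `P` away from zero.

The bound for a fixed matrix is affine in `P` and `‖A‖_F²`, so integrating it over a Gaussian `A`
gives the same inequality. -/

namespace SupportRecovery

/-! ### Change of measure through a linearised divergence inequality. -/

section ChangeOfMeasure

variable {Ω : Type*} [MeasurableSpace Ω] {μ : Measure Ω} {p q : Ω → ℝ}

/-- A linearised form of the data processing inequality for the Kullback–Leibler divergence. -/
lemma mul_setIntegral_le_divergence_add (hp : ∀ x, 0 < p x) (hq : ∀ x, 0 < q x)
    (hpi : Integrable p μ) (hqi : Integrable q μ) (hpq : ∫ x, q x ∂μ ≤ ∫ x, p x ∂μ)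
    (hlog : Integrable (fun x => p x * (Real.log (p x) - Real.log (q x))) μ)
    {E : Set Ω} (hE : MeasurableSet E) (c : ℝ) :
    c * ∫ x in E, p x ∂μ ≤
      ∫ x, p x * (Real.log (p x) - Real.log (q x)) ∂μ + Real.exp c * ∫ x in E, q x ∂μ := by
  have key : ∀ x, c * E.indicator p x ≤ (p x * (Real.log (p x) - Real.log (q x)) - p x + q x)
      + Real.exp c * E.indicator q x := by
    intro x
    -- This is `log u ≤ u - 1` at `u = q e^s / p`. It is used with `s = c` on `E` and `s = 0` off
    -- `E`; on `E` the extra `q` on the right is slack.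
    have aux : ∀ s : ℝ, s * p x ≤
        p x * (Real.log (p x) - Real.log (q x)) - p x + q x * Real.exp s := by
      intro s
      have h := Real.log_le_sub_one_of_pos
        (div_pos (mul_pos (hq x) (Real.exp_pos s)) (hp x))
      rw [Real.log_div (mul_pos (hq x) (Real.exp_pos s)).ne' (hp x).ne',
        Real.log_mul (hq x).ne' (Real.exp_pos s).ne', Real.log_exp] at h
      have h2 := mul_le_mul_of_nonneg_left h (hp x).le
      have h3 : p x * (q x * Real.exp s / p x - 1) = q x * Real.exp s - p x := by
        have := (hp x).ne'
        field_simp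
      rw [h3] at h2
      linarith
    by_cases hx : x ∈ E
    · simp only [Set.indicator_of_mem hx]
      have := aux c
      have := hq x
      linarith
    · simp only [Set.indicator_of_notMem hx]
      have := aux 0
      simp only [Real.exp_zero] at this
      linarith
  have hmono := integral_mono ((hpi.indicator hE).const_mul c)
    (((hlog.sub hpi).add hqi).add ((hqi.indicator hE).const_mul (Real.exp c))) key
  have e1 : ∫ x, c * E.indicator p x ∂μ = c * ∫ x in E, p x ∂μ := by
    rw [integral_const_mul, integral_indicator hE]
  have e2 : ∫ x, (p x * (Real.log (p x) - Real.log (q x)) - p x + q x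
      + Real.exp c * E.indicator q x) ∂μ
      = ∫ x, p x * (Real.log (p x) - Real.log (q x)) ∂μ - ∫ x, p x ∂μ + ∫ x, q x ∂μ
        + Real.exp c * ∫ x in E, q x ∂μ := by
    have i1 : Integrable (fun x => p x * (Real.log (p x) - Real.log (q x)) - p x) μ :=
      hlog.sub hpi
    have i2 : Integrable (fun x => p x * (Real.log (p x) - Real.log (q x)) - p x + q x) μ :=
      i1.add hqi
    rw [integral_add i2 ((hqi.indicator hE).const_mul (Real.exp c)),
      integral_add i1 hqi, integral_sub hlog hpi, integral_const_mul,
      integral_indicator hE]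
  have hmono' : ∫ x, c * E.indicator p x ∂μ ≤
      ∫ x, (p x * (Real.log (p x) - Real.log (q x)) - p x + q x
      + Real.exp c * E.indicator q x) ∂μ := hmono
  rw [e1, e2] at hmono'
  linarith

end ChangeOfMeasure

/-! ### Gaussian product densities and their linear images. -/

/-- The product of finitely many measures with densities has the product density. -/
lemma pi_withDensity_ofReal {ι : Type*} [Fintype ι] {X : ι → Type*} [∀ i, MeasurableSpace (X i)]
    (μ : ∀ i, Measure (X i)) [∀ i, SigmaFinite (μ i)] (f : ∀ i, X i → ℝ)
    (hf : ∀ i x, 0 ≤ f i x) (hi : ∀ i, Integrable (f i) (μ i)) :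
    Measure.pi (fun i => (μ i).withDensity fun x => ENNReal.ofReal (f i x)) =
      (Measure.pi μ).withDensity fun x => ENNReal.ofReal (∏ i, f i (x i)) := by
  have : ∀ i, IsFiniteMeasure ((μ i).withDensity fun x => ENNReal.ofReal (f i x)) :=
    fun i => isFiniteMeasure_withDensity_ofReal (hi i).2
  refine Measure.pi_eq fun s hs => ?_
  rw [withDensity_apply _ (MeasurableSet.univ_pi hs), Measure.restrict_pi_pi,
    ← ofReal_integral_eq_lintegral_ofReal
      (Integrable.fintype_prod_dep fun i => (hi i).restrict)
      (ae_of_all _ fun x => Finset.prod_nonneg fun i _ => hf i _),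
    integral_fintype_prod_eq_prod,
    ENNReal.ofReal_prod_of_nonneg fun i _ => integral_nonneg (hf i)]
  refine Finset.prod_congr rfl fun i _ => ?_
  rw [withDensity_apply _ (hs i), ofReal_integral_eq_lintegral_ofReal (hi i).restrict
    (ae_of_all _ (hf i))]

section GaussianDensity

variable {ι κ : Type*} [Fintype ι] [Fintype κ]

/-- The density of a vector with i.i.d. `N(0, v)` entries. -/
noncomputable def vecDensity (v : ℝ≥0) (z : ι → ℝ) : ℝ := ∏ j, gaussianPDFReal 0 v (z j)

/-- The density of a matrix whose rows are i.i.d. with density `f`. -/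
noncomputable def rowsDensity (f : (ι → ℝ) → ℝ) (z : κ → ι → ℝ) : ℝ := ∏ i, f (z i)

lemma vecDensity_pos {v : ℝ≥0} (hv : 0 < v) (z : ι → ℝ) : 0 < vecDensity v z :=
  Finset.prod_pos fun _ _ => gaussianPDFReal_pos _ _ _ hv.ne'

lemma integrable_vecDensity (v : ℝ≥0) : Integrable (vecDensity (ι := ι) v) :=
  Integrable.fintype_prod fun _ => integrable_gaussianPDFReal 0 v

lemma integral_vecDensity {v : ℝ≥0} (hv : 0 < v) : ∫ z : ι → ℝ, vecDensity v z = 1 := by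
  unfold vecDensity
  rw [integral_fintype_prod_volume_eq_prod (fun _ : ι => gaussianPDFReal 0 v)]
  simp [integral_gaussianPDFReal_eq_one 0 hv.ne']

lemma pi_gaussianReal {v : ℝ≥0} (hv : 0 < v) :
    Measure.pi (fun _ : ι => gaussianReal 0 v) =
      volume.withDensity fun z => ENNReal.ofReal (vecDensity v z) := by
  have := pi_withDensity_ofReal (fun _ : ι => (volume : Measure ℝ))
    (fun _ => gaussianPDFReal 0 v) (fun _ => gaussianPDFReal_nonneg 0 v)
    (fun _ => integrable_gaussianPDFReal 0 v)
  rw [gaussianReal_of_var_ne_zero _ hv.ne']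
  exact this

lemma pi_pi_gaussianReal {v : ℝ≥0} (hv : 0 < v) :
    Measure.pi (fun _ : κ => Measure.pi fun _ : ι => gaussianReal 0 v) =
      volume.withDensity fun z => ENNReal.ofReal (rowsDensity (vecDensity v) z) := by
  rw [pi_gaussianReal hv]
  exact pi_withDensity_ofReal (fun _ : κ => (volume : Measure (ι → ℝ)))
    (fun _ => vecDensity v) (fun _ z => (vecDensity_pos hv z).le)
    (fun _ => integrable_vecDensity v)

lemma rowsDensity_pos {ι κ : Type*} [Fintype κ] {f : (ι → ℝ) → ℝ} (hf : ∀ z, 0 < f z) (z : κ → ι → ℝ) :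
    0 < rowsDensity f z := Finset.prod_pos fun _ _ => hf _

lemma integrable_rowsDensity {f : (ι → ℝ) → ℝ} (hf : Integrable f) :
    Integrable (rowsDensity (κ := κ) f) :=
  Integrable.fintype_prod fun _ => hf

lemma integral_rowsDensity {f : (ι → ℝ) → ℝ} (hf : ∫ z, f z = 1) :
    ∫ z : κ → ι → ℝ, rowsDensity f z = 1 := by
  unfold rowsDensity
  rw [integral_fintype_prod_volume_eq_prod (fun _ : κ => f)]
  simp [hf]

variable [DecidableEq ι]

/-- The density of `L⁻¹ z`, where `z` has i.i.d. `N(0, v)` entries. -/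
noncomputable def transformedDensity (L : Matrix ι ι ℝ) (v : ℝ≥0) (y : ι → ℝ) : ℝ :=
  |L.det| * vecDensity v (L *ᵥ y)

lemma transformedDensity_pos {L : Matrix ι ι ℝ} (hL : L.det ≠ 0) {v : ℝ≥0} (hv : 0 < v)
    (y : ι → ℝ) : 0 < transformedDensity L v y :=
  mul_pos (abs_pos.2 hL) (vecDensity_pos hv _)

lemma measurableEmbedding_mulVec {L : Matrix ι ι ℝ} (hL : L.det ≠ 0) :
    MeasurableEmbedding fun y : ι → ℝ => L *ᵥ y := by
  have hu : IsUnit L.det := isUnit_iff_ne_zero.2 hL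
  have hinj : Function.Injective L.mulVec :=
    Matrix.mulVec_injective_iff_isUnit.2 ((Matrix.isUnit_iff_isUnit_det L).2 hu)
  exact Continuous.measurableEmbedding (by fun_prop) hinj

lemma map_mulVec_volume {L : Matrix ι ι ℝ} (hL : L.det ≠ 0) :
    Measure.map (fun y : ι → ℝ => L *ᵥ y) volume = ENNReal.ofReal |L.det|⁻¹ • volume := by
  have := Real.map_matrix_volume_pi_eq_smul_volume_pi hL
  rw [abs_inv] at this
  exact this

lemma integrable_transformedDensity {L : Matrix ι ι ℝ} (hL : L.det ≠ 0) (v : ℝ≥0) :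
    Integrable (transformedDensity L v) := by
  refine Integrable.const_mul ?_ _
  refine ((measurableEmbedding_mulVec hL).integrable_map_iff (μ := volume)
    (g := vecDensity v)).1 ?_
  rw [map_mulVec_volume hL]
  exact (integrable_vecDensity v).smul_measure ENNReal.ofReal_ne_top

lemma integral_transformedDensity {L : Matrix ι ι ℝ} (hL : L.det ≠ 0) {v : ℝ≥0} (hv : 0 < v) :
    ∫ y, transformedDensity L v y = 1 := by
  unfold transformedDensity
  rw [integral_const_mul, ← (measurableEmbedding_mulVec hL).integral_map (μ := volume)
    (vecDensity v), map_mulVec_volume hL, integral_smul_measure, integral_vecDensity hv,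
    ENNReal.toReal_ofReal (by positivity)]
  simp [hL]

lemma log_vecDensity {ι : Type*} [Fintype ι] {v : ℝ≥0} (hv : 0 < v) (z : ι → ℝ) :
    Real.log (vecDensity v z) =
      Fintype.card ι * Real.log (√(2 * Real.pi * v))⁻¹ - (∑ j, z j ^ 2) / (2 * v) := by
  have hv' : (0 : ℝ) < v := hv
  unfold vecDensity
  rw [Real.log_prod fun j _ => (gaussianPDFReal_pos _ _ _ hv.ne').ne']
  have : ∀ j, Real.log (gaussianPDFReal 0 v (z j)) =
      Real.log (√(2 * Real.pi * v))⁻¹ - z j ^ 2 / (2 * v) := by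
    intro j
    rw [gaussianPDFReal, Real.log_mul (by positivity) (Real.exp_pos _).ne', Real.log_exp]
    ring
  simp_rw [this]
  rw [Finset.sum_sub_distrib, Finset.sum_div]
  simp

lemma log_vecDensity_sub_log_transformedDensity {L : Matrix ι ι ℝ} (hL : L.det ≠ 0)
    {v : ℝ≥0} (hv : 0 < v) (z y : ι → ℝ) :
    Real.log (vecDensity v z) - Real.log (transformedDensity L v y) =
      -Real.log |L.det| - (∑ j, z j ^ 2) / (2 * v) + (∑ j, (L *ᵥ y) j ^ 2) / (2 * v) := by
  rw [transformedDensity, Real.log_mul (abs_pos.2 hL).ne' (vecDensity_pos hv _).ne',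
    log_vecDensity hv, log_vecDensity hv]
  ring

end GaussianDensity

/-! ### Second moments and the expected log-likelihood ratio of one row. -/

section Moments

variable {ι : Type*} [Fintype ι]

lemma memLp_id_gaussianReal_two (v : ℝ≥0) : MemLp (fun x : ℝ => x) 2 (gaussianReal 0 v) :=
  memLp_id_gaussianReal 2

lemma memLp_two_affine_pi_gaussianReal (v : ℝ≥0) (c : ι → ℝ) (b : ℝ) :
    MemLp (fun z : ι → ℝ => ∑ j, c j * z j + b) 2 (Measure.pi fun _ : ι => gaussianReal 0 v) := by
  refine MemLp.add ?_ (memLp_const b)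
  refine memLp_finsetSum _ fun j _ => MemLp.const_mul ?_ (c j)
  exact (memLp_id_gaussianReal_two v).comp_measurePreserving (measurePreserving_eval _ j)

/-- The second moment of an affine function of a Gaussian vector with i.i.d. entries. -/
lemma integral_sq_affine_pi_gaussianReal (v : ℝ≥0) (c : ι → ℝ) (b : ℝ) :
    ∫ z, (∑ j, c j * z j + b) ^ 2 ∂(Measure.pi fun _ : ι => gaussianReal 0 v) =
      v * ∑ j, c j ^ 2 + b ^ 2 := by
  set γ := Measure.pi fun _ : ι => gaussianReal 0 v
  have hm := memLp_two_affine_pi_gaussianReal v c 0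
  have hvar : Var[fun z : ι → ℝ => ∑ j, c j * z j; γ] = v * ∑ j, c j ^ 2 := by
    have h := variance_sum_pi (μ := fun _ : ι => gaussianReal 0 v) (X := fun j x => c j * x)
      (fun j => (memLp_id_gaussianReal_two v).const_mul (c j))
    have h2 : ∀ j, Var[fun x => c j * x; gaussianReal 0 v] = v * c j ^ 2 := by
      intro j
      rw [variance_const_mul, variance_fun_id_gaussianReal]
      ring
    simp_rw [h2] at h
    rw [Finset.mul_sum, ← h]
    congr 1
    ext z
    simp
  have hmean : ∫ z, ∑ j, c j * z j ∂γ = 0 := by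
    rw [integral_finsetSum]
    · refine Finset.sum_eq_zero fun j _ => ?_
      rw [integral_const_mul]
      have : ∫ z : ι → ℝ, z j ∂γ = ∫ x, x ∂gaussianReal 0 v :=
        integral_eval (μ := fun _ : ι => gaussianReal 0 v)
      rw [this, integral_id_gaussianReal, mul_zero]
    · intro j _
      refine Integrable.const_mul ?_ _
      exact ((memLp_id_gaussianReal_two v).comp_measurePreserving
        (measurePreserving_eval _ j)).integrable one_le_two
  simp only [add_zero] at hm
  have hsq : ∫ z, (∑ j, c j * z j) ^ 2 ∂γ = v * ∑ j, c j ^ 2 := by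
    rw [← hvar, variance_of_integral_eq_zero hm.aemeasurable hmean]
  have hexp : ∀ z : ι → ℝ, (∑ j, c j * z j + b) ^ 2 =
      (∑ j, c j * z j) ^ 2 + 2 * b * (∑ j, c j * z j) + b ^ 2 := fun z => by ring
  simp_rw [hexp]
  have i1 : Integrable
      (fun z : ι → ℝ => (∑ j, c j * z j) ^ 2 + 2 * b * (∑ j, c j * z j)) γ :=
    hm.integrable_sq.add ((hm.integrable one_le_two).const_mul _)
  rw [integral_add i1 (integrable_const _), integral_add hm.integrable_sq ((hm.integrable one_le_two).const_mul _),
    integral_const_mul, hmean, hsq]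
  simp

lemma integrable_sq_affine_pi_gaussianReal (v : ℝ≥0) (c : ι → ℝ) (b : ℝ) :
    Integrable (fun z => (∑ j, c j * z j + b) ^ 2) (Measure.pi fun _ : ι => gaussianReal 0 v) :=
  (memLp_two_affine_pi_gaussianReal v c b).integrable_sq

lemma mulVec_add_eq_affine [DecidableEq ι] (L : Matrix ι ι ℝ) (z δ : ι → ℝ) (r : ι) :
    (L *ᵥ (z + δ)) r = ∑ j, L r j * z j + (L *ᵥ δ) r := by
  rw [Matrix.mulVec_add]
  rfl

/-- The log-likelihood ratio between white noise and a shifted transformed Gaussian vector. -/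
noncomputable def rowLogRatio [DecidableEq ι] (L : Matrix ι ι ℝ) (v : ℝ≥0) (δ z : ι → ℝ) : ℝ :=
  Real.log (vecDensity v z) - Real.log (transformedDensity L v (z + δ))

variable [DecidableEq ι] {L : Matrix ι ι ℝ} {v : ℝ≥0}

lemma rowLogRatio_eq (hL : L.det ≠ 0) (hv : 0 < v) (δ z : ι → ℝ) :
    rowLogRatio L v δ z = -Real.log |L.det| - (∑ j, z j ^ 2) / (2 * v) +
      (∑ r, (∑ j, L r j * z j + (L *ᵥ δ) r) ^ 2) / (2 * v) := by
  rw [rowLogRatio, log_vecDensity_sub_log_transformedDensity hL hv]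
  simp_rw [mulVec_add_eq_affine]

lemma integrable_sq_eval {ι : Type*} [Fintype ι] (v : ℝ≥0) (j : ι) :
    Integrable (fun z : ι → ℝ => z j ^ 2) (Measure.pi fun _ : ι => gaussianReal 0 v) :=
  ((memLp_id_gaussianReal_two v).comp_measurePreserving (measurePreserving_eval _ j)).integrable_sq

lemma integral_sq_eval (v : ℝ≥0) (j : ι) :
    ∫ z : ι → ℝ, z j ^ 2 ∂(Measure.pi fun _ : ι => gaussianReal 0 v) = v := by
  have := integral_sq_affine_pi_gaussianReal v (fun i : ι => if i = j then 1 else 0) 0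
  simpa using this

lemma integrable_rowLogRatio (hL : L.det ≠ 0) (hv : 0 < v) (δ : ι → ℝ) :
    Integrable (rowLogRatio L v δ) (Measure.pi fun _ : ι => gaussianReal 0 v) := by
  have h : rowLogRatio L v δ = fun z => -Real.log |L.det| - (∑ j, z j ^ 2) / (2 * v) +
      (∑ r, (∑ j, L r j * z j + (L *ᵥ δ) r) ^ 2) / (2 * v) :=
    funext fun z => rowLogRatio_eq hL hv δ z
  rw [h]
  refine ((integrable_const _).sub (Integrable.div_const ?_ _)).add (Integrable.div_const ?_ _)
  · exact integrable_finsetSum _ fun j _ => integrable_sq_eval v j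
  · exact integrable_finsetSum _ fun r _ => integrable_sq_affine_pi_gaussianReal v _ _

/-- White noise has `E|L(z + δ)|² = v tr(LᵀL) + |Lδ|²` and `E|z|² = v · card ι`. The value is the
divergence of `N(0, v I)` from `N(-δ, v (LᵀL)⁻¹)`. -/
lemma integral_rowLogRatio (hL : L.det ≠ 0) (hv : 0 < v) (δ : ι → ℝ) :
    ∫ z, rowLogRatio L v δ z ∂(Measure.pi fun _ : ι => gaussianReal 0 v) =
      -Real.log |L.det| - Fintype.card ι / 2 + (Lᵀ * L).trace / 2 +
        (∑ r, (L *ᵥ δ) r ^ 2) / (2 * v) := by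
  have hv' : (v : ℝ) ≠ 0 := NNReal.coe_ne_zero.2 hv.ne'
  have i1 : Integrable (fun z : ι → ℝ => (∑ j, z j ^ 2) / (2 * (v : ℝ)))
      (Measure.pi fun _ : ι => gaussianReal 0 v) :=
    (integrable_finsetSum _ fun j _ => integrable_sq_eval v j).div_const _
  have i2 : Integrable (fun z : ι → ℝ =>
      (∑ r, (∑ j, L r j * z j + (L *ᵥ δ) r) ^ 2) / (2 * (v : ℝ)))
      (Measure.pi fun _ : ι => gaussianReal 0 v) :=
    (integrable_finsetSum _ fun r _ => integrable_sq_affine_pi_gaussianReal v _ _).div_const _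
  have i0 : Integrable
      (fun z : ι → ℝ => -Real.log |L.det| - (∑ j, z j ^ 2) / (2 * (v : ℝ)))
      (Measure.pi fun _ : ι => gaussianReal 0 v) := (integrable_const _).sub i1
  simp_rw [rowLogRatio_eq hL hv]
  rw [integral_add i0 i2, integral_sub (integrable_const _) i1,
    integral_div, integral_div, integral_finsetSum _ fun j _ => integrable_sq_eval v j,
    integral_finsetSum _ fun r _ =>
      integrable_sq_affine_pi_gaussianReal v (fun j => L r j) ((L *ᵥ δ) r)]
  have h2 : ∀ r, ∫ z, (∑ j, L r j * z j + (L *ᵥ δ) r) ^ 2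
      ∂(Measure.pi fun _ : ι => gaussianReal 0 v) = v * ∑ j, L r j ^ 2 + (L *ᵥ δ) r ^ 2 :=
    fun r => integral_sq_affine_pi_gaussianReal v (fun j => L r j) ((L *ᵥ δ) r)
  simp_rw [integral_sq_eval, h2]
  have htr : (Lᵀ * L).trace = ∑ r, ∑ j, L r j ^ 2 := by
    simp only [Matrix.trace, Matrix.diag, Matrix.mul_apply, Matrix.transpose_apply]
    rw [Finset.sum_comm]
    simp_rw [sq]
  rw [Finset.sum_add_distrib, ← Finset.mul_sum, ← htr]
  simp
  field_simp
  ring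

end Moments

/-! ### Divergence of matrices with independent rows. -/

section MatrixDivergence

variable {ι κ : Type*} [Fintype ι] [Fintype κ] {v : ℝ≥0}

lemma measurable_vecDensity (v : ℝ≥0) : Measurable (vecDensity (ι := ι) v) := by
  unfold vecDensity
  have := measurable_gaussianPDFReal 0 v
  fun_prop

lemma measurable_rowsDensity_vecDensity (v : ℝ≥0) :
    Measurable (rowsDensity (κ := κ) (vecDensity (ι := ι) v)) := by
  unfold rowsDensity
  have := measurable_vecDensity (ι := ι) v
  fun_prop

lemma integral_pi_pi_gaussianReal (hv : 0 < v) (F : (κ → ι → ℝ) → ℝ) :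
    ∫ z, F z ∂(Measure.pi fun _ : κ => Measure.pi fun _ : ι => gaussianReal 0 v) =
      ∫ z, rowsDensity (vecDensity v) z * F z := by
  rw [pi_pi_gaussianReal hv, integral_withDensity_eq_integral_toReal_smul]
  · refine integral_congr_ae (ae_of_all _ fun z => ?_)
    simp only [smul_eq_mul]
    rw [ENNReal.toReal_ofReal (rowsDensity_pos (vecDensity_pos hv) z).le]
  · exact (measurable_rowsDensity_vecDensity v).ennreal_ofReal
  · exact ae_of_all _ fun z => ENNReal.ofReal_lt_top

lemma integrable_pi_pi_gaussianReal_iff (hv : 0 < v) (F : (κ → ι → ℝ) → ℝ) :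
    Integrable F (Measure.pi fun _ : κ => Measure.pi fun _ : ι => gaussianReal 0 v) ↔
      Integrable fun z => rowsDensity (vecDensity v) z * F z := by
  rw [pi_pi_gaussianReal hv, integrable_withDensity_iff_integrable_smul']
  · refine integrable_congr (ae_of_all _ fun z => ?_)
    simp only [smul_eq_mul]
    rw [ENNReal.toReal_ofReal (rowsDensity_pos (vecDensity_pos hv) z).le]
  · exact (measurable_rowsDensity_vecDensity v).ennreal_ofReal
  · exact ae_of_all _ fun z => ENNReal.ofReal_lt_top

variable [DecidableEq ι] {L : Matrix ι ι ℝ}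

/-- The divergence between white noise and the shifted transformed Gaussian vector. -/
noncomputable def rowDivergence (L : Matrix ι ι ℝ) (v : ℝ≥0) (δ : ι → ℝ) : ℝ :=
  -Real.log |L.det| - Fintype.card ι / 2 + (Lᵀ * L).trace / 2 + (∑ r, (L *ᵥ δ) r ^ 2) / (2 * v)

lemma log_rowsDensity_sub_log_rowsDensity (hL : L.det ≠ 0) (hv : 0 < v) (δ z : κ → ι → ℝ) :
    Real.log (rowsDensity (vecDensity v) z) -
      Real.log (rowsDensity (transformedDensity L v) (z + δ)) =
      ∑ i, rowLogRatio L v (δ i) (z i) := by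
  unfold rowsDensity rowLogRatio
  rw [Real.log_prod fun i _ => (vecDensity_pos hv _).ne',
    Real.log_prod fun i _ => (transformedDensity_pos hL hv _).ne', ← Finset.sum_sub_distrib]
  rfl

lemma integrable_sum_rowLogRatio (hL : L.det ≠ 0) (hv : 0 < v) (δ : κ → ι → ℝ) :
    Integrable (fun z : κ → ι → ℝ => ∑ i, rowLogRatio L v (δ i) (z i))
      (Measure.pi fun _ : κ => Measure.pi fun _ : ι => gaussianReal 0 v) :=
  integrable_finsetSum _ fun i _ => integrable_comp_eval
    (μ := fun _ : κ => Measure.pi fun _ : ι => gaussianReal 0 v)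
    (integrable_rowLogRatio hL hv (δ i))

lemma integral_sum_rowLogRatio (hL : L.det ≠ 0) (hv : 0 < v) (δ : κ → ι → ℝ) :
    ∫ z : κ → ι → ℝ, ∑ i, rowLogRatio L v (δ i) (z i)
      ∂(Measure.pi fun _ : κ => Measure.pi fun _ : ι => gaussianReal 0 v) =
      ∑ i, rowDivergence L v (δ i) := by
  rw [integral_finsetSum _ fun i _ => integrable_comp_eval
    (μ := fun _ : κ => Measure.pi fun _ : ι => gaussianReal 0 v)
    (integrable_rowLogRatio hL hv (δ i))]
  refine Finset.sum_congr rfl fun i _ => ?_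
  rw [integral_comp_eval (μ := fun _ : κ => Measure.pi fun _ : ι => gaussianReal 0 v)
    (integrable_rowLogRatio hL hv (δ i)).aestronglyMeasurable, integral_rowLogRatio hL hv,
    rowDivergence]

/-- The change of measure bound for a noisy observation `x + z` with Gaussian noise `z`,
compared with a Gaussian law of mean `ν`. -/
lemma mul_measureReal_le_sum_rowDivergence_add (hL : L.det ≠ 0) (hv : 0 < v)
    (x ν : κ → ι → ℝ) {E : Set (κ → ι → ℝ)} (hE : MeasurableSet E) (c : ℝ) :
    c * (Measure.pi fun _ : κ => Measure.pi fun _ : ι => gaussianReal 0 v).real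
        {z | x + z ∈ E} ≤
      ∑ i, rowDivergence L v (x i - ν i) +
        Real.exp c * ∫ y in E, rowsDensity (transformedDensity L v) (y - ν) := by
  set γ := Measure.pi fun _ : κ => Measure.pi fun _ : ι => gaussianReal 0 v with hγ
  set P : (κ → ι → ℝ) → ℝ := rowsDensity (vecDensity v) with hP
  set Q : (κ → ι → ℝ) → ℝ := rowsDensity (transformedDensity L v) with hQ
  have hPi : Integrable P := integrable_rowsDensity (integrable_vecDensity v)
  have hQi : Integrable Q := integrable_rowsDensity (integrable_transformedDensity hL v)
  have hshift : ∀ y, Real.log (P (y - x)) - Real.log (Q (y - ν)) =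
      ∑ i, rowLogRatio L v ((x - ν) i) ((y - x) i) := by
    intro y
    rw [← log_rowsDensity_sub_log_rowsDensity hL hv (x - ν) (y - x)]
    congr 3
    abel
  have hPF : Integrable fun z => P z * ∑ i, rowLogRatio L v ((x - ν) i) (z i) :=
    (integrable_pi_pi_gaussianReal_iff hv _).1 (integrable_sum_rowLogRatio hL hv _)
  have hmono : Integrable fun y => P (y - x) * (Real.log (P (y - x)) - Real.log (Q (y - ν))) := by
    simp_rw [hshift]
    exact hPF.comp_sub_right x
  have key := mul_setIntegral_le_divergence_add (μ := volume)
    (p := fun y => P (y - x)) (q := fun y => Q (y - ν))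
    (fun y => rowsDensity_pos (vecDensity_pos hv) _)
    (fun y => rowsDensity_pos (transformedDensity_pos hL hv) _)
    (hPi.comp_sub_right x) (hQi.comp_sub_right ν)
    (by rw [integral_sub_right_eq_self, integral_sub_right_eq_self,
          integral_rowsDensity (integral_vecDensity hv),
          integral_rowsDensity (integral_transformedDensity hL hv)]) hmono hE c
  have e1 : ∫ y in E, P (y - x) = γ.real {z | x + z ∈ E} := by
    have hE' : MeasurableSet {z | x + z ∈ E} := (measurable_const_add x) hE
    rw [← integral_indicator_one hE', hγ, integral_pi_pi_gaussianReal hv,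
      ← integral_indicator hE, ← integral_sub_right_eq_self
        (fun z => rowsDensity (vecDensity v) z * {z | x + z ∈ E}.indicator 1 z) x]
    refine integral_congr_ae (ae_of_all _ fun y => ?_)
    by_cases hy : y ∈ E
    · simp [hy, hP]
    · simp [hy]
  have e2 : ∫ y, P (y - x) * (Real.log (P (y - x)) - Real.log (Q (y - ν))) =
      ∑ i, rowDivergence L v (x i - ν i) := by
    simp_rw [hshift]
    rw [integral_sub_right_eq_self
      (fun z => P z * ∑ i, rowLogRatio L v ((x - ν) i) (z i)) x,
      ← integral_pi_pi_gaussianReal hv, integral_sum_rowLogRatio hL hv]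
    rfl
  rwa [e1, e2] at key

/-- The change of measure bound with the empty event and equal means is Gibbs' inequality. -/
lemma rowDivergence_zero_nonneg (hL : L.det ≠ 0) (hv : 0 < v) : 0 ≤ rowDivergence L v 0 := by
  have := mul_measureReal_le_sum_rowDivergence_add (κ := Unit) hL hv 0 0 MeasurableSet.empty 0
  simpa using this

end MatrixDivergence

/-! ### Counting location vectors with a given range or given entries off `T`. -/

section Counting

variable {k m : ℕ}

/-- Once one `S₀` with range `B` is fixed, any other factors as `S₀ ∘ f` with `f : Fin k → Fin k`.
The bound is cruder than `k!`, but all that matters is that it does not depend on `m`. -/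
lemma card_filter_range_eq_le (B : Set (Fin m)) [DecidablePred fun S : Fin k ↪ Fin m =>
    Set.range S = B] :
    (Finset.univ.filter fun S : Fin k ↪ Fin m => Set.range S = B).card ≤ k ^ k := by
  rcases Finset.eq_empty_or_nonempty
    (Finset.univ.filter fun S : Fin k ↪ Fin m => Set.range S = B) with h | ⟨S₀, hS₀⟩
  · simp [h]
  have h₀ : Set.range S₀ = B := (Finset.mem_filter.1 hS₀).2
  have hex : ∀ S : Fin k ↪ Fin m, Set.range S = B → ∀ j, ∃ i, S₀ i = S j := by
    intro S hS j
    have : S j ∈ Set.range S₀ := by rw [h₀, ← hS]; exact Set.mem_range_self j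
    exact this
  classical
  let f : (Fin k ↪ Fin m) → Fin k → Fin k := fun S j =>
    if h : ∃ i, S₀ i = S j then h.choose else j
  have hf : ∀ S : Fin k ↪ Fin m, Set.range S = B → ∀ j, S₀ (f S j) = S j := by
    intro S hS j
    simp only [f, dif_pos (hex S hS j)]
    exact (hex S hS j).choose_spec
  have hcard := Finset.card_le_card_of_injOn (t := (Finset.univ : Finset (Fin k → Fin k))) f
    (fun _ _ => Finset.mem_univ _) (s := Finset.univ.filter fun S : Fin k ↪ Fin m =>
      Set.range S = B) (by
        intro S hS S' hS' hff
        have h1 := (Finset.mem_filter.1 hS).2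
        have h2 := (Finset.mem_filter.1 hS').2
        ext j
        rw [← hf S h1 j, ← hf S' h2 j, hff])
  simpa using hcard

/-- Overwriting the locations indexed by `T`. -/
def overwrite (T : Finset (Fin k)) (S : Fin k ↪ Fin m)
    (e : T ↪ {p : Fin m // p ∉ Tᶜ.map S}) : Fin k ↪ Fin m where
  toFun j := if h : j ∈ T then (e ⟨j, h⟩ : Fin m) else S j
  inj' := by
    intro i j hij
    have hmem : ∀ i, i ∉ T → S i ∈ Tᶜ.map S := fun i hi =>
      Finset.mem_map_of_mem _ (Finset.mem_compl.2 hi)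
    by_cases hi : i ∈ T <;> by_cases hj : j ∈ T <;> simp only [hi, hj, dif_pos, dif_neg,
      not_false_eq_true] at hij
    · have := e.injective (Subtype.ext hij)
      simpa using this
    · exact absurd (hij ▸ hmem j hj) (e ⟨i, hi⟩).2
    · exact absurd (hij ▸ hmem i hi) (e ⟨j, hj⟩).2
    · exact S.injective hij

lemma overwrite_apply_of_mem {T : Finset (Fin k)} {S : Fin k ↪ Fin m}
    (e : T ↪ {p : Fin m // p ∉ Tᶜ.map S}) {j : Fin k} (hj : j ∈ T) :
    overwrite T S e j = e ⟨j, hj⟩ := dif_pos hj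

lemma overwrite_apply_of_notMem {T : Finset (Fin k)} {S : Fin k ↪ Fin m}
    (e : T ↪ {p : Fin m // p ∉ Tᶜ.map S}) {j : Fin k} (hj : j ∉ T) :
    overwrite T S e j = S j := dif_neg hj

/-- The entries in `T` may be any injective choice among the `m - k + |T|` positions not occupied by
the others; the smallest factor of the resulting falling factorial is `m - k + 1`. -/
lemma pow_le_card_filter_agree (hkm : k ≤ m) (T : Finset (Fin k)) (S : Fin k ↪ Fin m)
    [DecidablePred fun S' : Fin k ↪ Fin m => ∀ j ∉ T, S' j = S j] :
    (m - k + 1) ^ T.card ≤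
      (Finset.univ.filter fun S' : Fin k ↪ Fin m => ∀ j ∉ T, S' j = S j).card := by
  have htk : T.card ≤ k := by simpa using T.card_le_univ
  have hX : Fintype.card {p : Fin m // p ∉ Tᶜ.map S} = m - (k - T.card) := by
    rw [Fintype.card_subtype_compl (fun p => p ∈ Tᶜ.map S), Fintype.card_coe, Finset.card_map,
      Finset.card_compl, Fintype.card_fin, Fintype.card_fin]
  have hcard : (m - k + 1) ^ T.card ≤
      Fintype.card (T ↪ {p : Fin m // p ∉ Tᶜ.map S}) := by
    rw [Fintype.card_embedding_eq, hX, Fintype.card_coe]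
    refine le_trans (Nat.pow_le_pow_left ?_ _) (Nat.pow_sub_le_descFactorial _ _)
    omega
  refine hcard.trans ?_
  rw [← Finset.card_univ]
  refine Finset.card_le_card_of_injOn (overwrite T S) (fun e _ => ?_) fun e _ e' _ h => ?_
  · rw [Finset.mem_coe, Finset.mem_filter]
    exact ⟨Finset.mem_univ _, fun j hj => overwrite_apply_of_notMem e hj⟩
  · ext ⟨j, hj⟩
    have := DFunLike.congr_fun h j
    rw [overwrite_apply_of_mem e hj, overwrite_apply_of_mem e' hj] at this
    rw [this]

open Classical in
/-- Among the locations with prescribed entries off `T`, few have a given range. -/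
lemma pow_mul_sum_range_eq_le (hkm : k ≤ m) (T : Finset (Fin k)) (B : Set (Fin m))
    (h : (Fin k ↪ Fin m) → ℝ) (h0 : ∀ S, 0 ≤ h S)
    (hT : ∀ S S', (∀ j ∉ T, S' j = S j) → h S' = h S) :
    ((m - k + 1 : ℕ) : ℝ) ^ T.card * ∑ S : Fin k ↪ Fin m, (if Set.range S = B then h S else 0) ≤
      (k : ℝ) ^ k * ∑ S, h S := by
  -- Double count of pairs `(S, S')` agreeing off `T` with `range S = B`: each such `S` has many
  -- partners `S'`, all with `h S' = h S`, while each `S'` has at most `k ^ k` partners `S`.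
  have h1 : ∀ S : Fin k ↪ Fin m, ((m - k + 1 : ℕ) : ℝ) ^ T.card * (if Set.range S = B then h S else 0) ≤
      ∑ S' : Fin k ↪ Fin m, if Set.range S = B ∧ ∀ j ∉ T, S' j = S j then h S' else 0 := by
    intro S
    by_cases hS : Set.range S = B
    · simp only [hS, if_true, true_and]
      rw [← Finset.sum_filter, Finset.sum_congr rfl fun S' hS' =>
        hT S S' (Finset.mem_filter.1 hS').2, Finset.sum_const, nsmul_eq_mul]
      refine mul_le_mul_of_nonneg_right ?_ (h0 S)
      exact_mod_cast pow_le_card_filter_agree hkm T S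
    · simp [hS]
  rw [Finset.mul_sum]
  refine (Finset.sum_le_sum fun S _ => h1 S).trans ?_
  rw [Finset.sum_comm, Finset.mul_sum]
  refine Finset.sum_le_sum fun S' _ => ?_
  rw [← Finset.sum_filter, Finset.sum_const, nsmul_eq_mul]
  refine mul_le_mul_of_nonneg_right ?_ (h0 S')
  have := (Finset.card_le_card (Finset.monotone_filter_right Finset.univ
    (fun (S : Fin k ↪ Fin m) _ (hS : Set.range S = B ∧ ∀ j ∉ T, S' j = S j) => hS.1))).trans
    (card_filter_range_eq_le (k := k) B)
  exact_mod_cast this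

end Counting

/-! ### Variance of linear statistics under sampling without replacement. -/

section PermutationAverage

variable {α : Type*} [Fintype α] [DecidableEq α]

lemma sum_perm_mul_apply (g : α → ℝ) (σ : Equiv.Perm α) (a b : α) :
    ∑ π : Equiv.Perm α, g (π (σ a)) * g (π (σ b)) = ∑ π : Equiv.Perm α, g (π a) * g (π b) :=
  Fintype.sum_equiv (Equiv.mulRight σ) _ _ fun π => by simp

lemma card_mul_sum_perm_sq (g : α → ℝ) (a : α) :
    (Fintype.card α : ℝ) * ∑ π : Equiv.Perm α, g (π a) * g (π a) =
      (Fintype.card α).factorial * ∑ p, g p ^ 2 := by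
  have h1 : ∀ b, ∑ π : Equiv.Perm α, g (π b) * g (π b) =
      ∑ π : Equiv.Perm α, g (π a) * g (π a) := by
    intro b
    have := sum_perm_mul_apply g (Equiv.swap a b) a a
    simpa using this
  have h2 : ∑ b, ∑ π : Equiv.Perm α, g (π b) * g (π b) =
      (Fintype.card α).factorial * ∑ p, g p ^ 2 := by
    rw [Finset.sum_comm]
    have : ∀ π : Equiv.Perm α, ∑ b, g (π b) * g (π b) = ∑ p, g p ^ 2 := fun π =>
      Fintype.sum_equiv π _ _ fun b => (sq _).symm
    simp_rw [this]
    simp [Fintype.card_perm]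
  rw [← h2]
  simp_rw [h1]
  simp

/-- Since `g` sums to zero, the correlations of `g (π a)` with all `g (π c)` cancel; by symmetry
those with `c ≠ a` are equal, so they share the negative of the diagonal term. -/
lemma card_sub_one_mul_sum_perm_mul (g : α → ℝ) (hg : ∑ p, g p = 0) {a b : α} (hab : a ≠ b) :
    ((Fintype.card α : ℝ) - 1) * ∑ π : Equiv.Perm α, g (π a) * g (π b) =
      -∑ π : Equiv.Perm α, g (π a) * g (π a) := by
  have h1 : ∀ c ∈ Finset.univ.erase a, ∑ π : Equiv.Perm α, g (π a) * g (π c) =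
      ∑ π : Equiv.Perm α, g (π a) * g (π b) := by
    intro c hc
    have hca : c ≠ a := Finset.ne_of_mem_erase hc
    have := sum_perm_mul_apply g (Equiv.swap b c) a b
    rwa [Equiv.swap_apply_of_ne_of_ne hab hca.symm, Equiv.swap_apply_left] at this
  have h2 : ∑ c, ∑ π : Equiv.Perm α, g (π a) * g (π c) = 0 := by
    rw [Finset.sum_comm]
    refine Finset.sum_eq_zero fun π _ => ?_
    rw [← Finset.mul_sum, Equiv.sum_comp π g, hg, mul_zero]
  rw [← Finset.add_sum_erase _ _ (Finset.mem_univ a), Finset.sum_congr rfl h1,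
    Finset.sum_const, Finset.card_erase_of_mem (Finset.mem_univ a), Finset.card_univ,
    nsmul_eq_mul, Nat.cast_sub (Fintype.card_pos_iff.2 ⟨a⟩)] at h2
  push_cast at h2
  linarith

/-- The variance bound for linear statistics of sampling without replacement, averaged over
permutations of the population. -/
lemma sum_perm_sq_le {β : Type*} [DecidableEq β] (hα : 1 < Fintype.card α) (g : α → ℝ)
    (hg : ∑ p, g p = 0) (T : Finset β) (u : β → ℝ) (S : β ↪ α) :
    ∑ π : Equiv.Perm α, (∑ j ∈ T, u j * g (π (S j))) ^ 2 ≤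
      (Fintype.card α).factorial * ((∑ j ∈ T, u j ^ 2) * (∑ p, g p ^ 2) /
        (Fintype.card α - 1)) := by
  obtain ⟨N, hN⟩ : ∃ N : ℝ, N = Fintype.card α := ⟨_, rfl⟩
  rw [← hN]
  have hN1 : 0 < N - 1 := by
    have : (1 : ℝ) < N := by rw [hN]; exact_mod_cast hα
    linarith
  obtain ⟨G, hG⟩ : ∃ G : ℝ, G = (Fintype.card α).factorial * ∑ p, g p ^ 2 := ⟨_, rfl⟩
  have hG0 : 0 ≤ G := by rw [hG]; positivity
  -- The covariance matrix is a multiple of the identity minus a multiple of the all-ones matrix.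
  -- The latter contributes a nonpositive term to the quadratic form and is dropped.
  have hc : ∀ i j, ∑ π : Equiv.Perm α, g (π (S i)) * g (π (S j)) =
      (if i = j then G / (N - 1) else 0) - G / (N * (N - 1)) := by
    intro i j
    have hd := card_mul_sum_perm_sq g (S i)
    rw [← hN, ← hG] at hd
    have hN0 : N ≠ 0 := by linarith
    rw [mul_comm, ← eq_div_iff hN0] at hd
    by_cases hij : i = j
    · subst hij
      rw [if_pos rfl, hd]
      field_simp
    · have ho := card_sub_one_mul_sum_perm_mul g hg (S.injective.ne hij)
      rw [← hN, hd, mul_comm, ← eq_div_iff hN1.ne'] at ho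
      rw [if_neg hij, ho]
      field_simp
      ring
  have hexp : ∑ π : Equiv.Perm α, (∑ j ∈ T, u j * g (π (S j))) ^ 2 =
      ∑ i ∈ T, ∑ j ∈ T, u i * u j * ∑ π : Equiv.Perm α, g (π (S i)) * g (π (S j)) := by
    simp_rw [sq, Finset.sum_mul_sum, Finset.mul_sum]
    rw [Finset.sum_comm]
    refine Finset.sum_congr rfl fun i _ => ?_
    rw [Finset.sum_comm]
    refine Finset.sum_congr rfl fun j _ => Finset.sum_congr rfl fun π _ => ?_
    ring
  rw [hexp]
  simp_rw [hc, mul_sub (_ * _ : ℝ), Finset.sum_sub_distrib]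
  have h1 : ∑ i ∈ T, ∑ j ∈ T, u i * u j * (if i = j then G / (N - 1) else 0) =
      (∑ j ∈ T, u j ^ 2) * (G / (N - 1)) := by
    rw [Finset.sum_mul]
    refine Finset.sum_congr rfl fun i hi => ?_
    simp [hi, sq]
  have h2 : ∑ i ∈ T, ∑ j ∈ T, u i * u j * (G / (N * (N - 1))) =
      (∑ j ∈ T, u j) ^ 2 * (G / (N * (N - 1))) := by
    rw [sq, Finset.sum_mul_sum, Finset.sum_mul]
    simp_rw [Finset.sum_mul]
  rw [h1, h2]
  have h3 : 0 ≤ (∑ j ∈ T, u j) ^ 2 * (G / (N * (N - 1))) := by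
    have : 0 < N := by linarith
    positivity
  have h4 : (Fintype.card α).factorial * ((∑ j ∈ T, u j ^ 2) * (∑ p, g p ^ 2) / (N - 1)) =
      (∑ j ∈ T, u j ^ 2) * (G / (N - 1)) := by
    rw [hG]; ring
  rw [h4]
  linarith

/-- The variance bound for linear statistics of sampling without replacement. -/
lemma sum_embedding_sq_le {β : Type*} [Fintype β] [DecidableEq β] (hα : 1 < Fintype.card α)
    (g : α → ℝ) (hg : ∑ p, g p = 0) (T : Finset β) (u : β → ℝ) :
    ∑ S : β ↪ α, (∑ j ∈ T, u j * g (S j)) ^ 2 ≤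
      Fintype.card (β ↪ α) * ((∑ j ∈ T, u j ^ 2) * (∑ p, g p ^ 2) / (Fintype.card α - 1)) := by
  -- Relabelling the population permutes the embeddings, so an additional average over permutations
  -- changes nothing and the bound for each fixed `S` applies.
  have hinv : ∀ π : Equiv.Perm α, ∑ S : β ↪ α, (∑ j ∈ T, u j * g (π (S j))) ^ 2 =
      ∑ S : β ↪ α, (∑ j ∈ T, u j * g (S j)) ^ 2 := fun π =>
    Fintype.sum_equiv (Equiv.embeddingCongr (Equiv.refl β) π) _ _ fun S => by
      simp [Equiv.embeddingCongr]
  have h1 : ∑ π : Equiv.Perm α, ∑ S : β ↪ α, (∑ j ∈ T, u j * g (π (S j))) ^ 2 =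
      (Fintype.card α).factorial * ∑ S : β ↪ α, (∑ j ∈ T, u j * g (S j)) ^ 2 := by
    simp_rw [hinv]
    simp [Fintype.card_perm]
  have h2 : ∑ π : Equiv.Perm α, ∑ S : β ↪ α, (∑ j ∈ T, u j * g (π (S j))) ^ 2 ≤
      ∑ S : β ↪ α, (Fintype.card α).factorial * ((∑ j ∈ T, u j ^ 2) * (∑ p, g p ^ 2) /
        (Fintype.card α - 1)) := by
    rw [Finset.sum_comm]
    exact Finset.sum_le_sum fun S _ => sum_perm_sq_le hα g hg T u S
  rw [h1, Finset.sum_const, Finset.card_univ, nsmul_eq_mul] at h2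
  have hf : (0 : ℝ) < (Fintype.card α).factorial := by positivity
  refine le_of_mul_le_mul_left ?_ hf
  linarith

/-- Centering reduces the sum of squares. -/
lemma sum_sub_mean_sq_le {α : Type*} [Fintype α] [Nonempty α] (a : α → ℝ) :
    ∑ p, (a p - (∑ q, a q) / Fintype.card α) ^ 2 ≤ ∑ p, a p ^ 2 := by
  have hN : (0 : ℝ) < Fintype.card α := by exact_mod_cast Fintype.card_pos
  have : ∑ p, (a p - (∑ q, a q) / Fintype.card α) ^ 2 =
      ∑ p, a p ^ 2 - (∑ q, a q) ^ 2 / Fintype.card α := by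
    simp_rw [sub_sq]
    rw [Finset.sum_add_distrib, Finset.sum_sub_distrib, ← Finset.sum_mul, ← Finset.mul_sum]
    simp
    field_simp
    ring
  rw [this]
  have : 0 ≤ (∑ q, a q) ^ 2 / Fintype.card α := by positivity
  linarith

end PermutationAverage

/-! ### Averages over the locations, and the form of the signal. -/

/-- No `k ≤ m` is needed: without location vectors both sides are zero, the right one by division by
zero. -/
lemma measureReal_locationLaw_prod {k m : ℕ} {Ω : Type*} [MeasurableSpace Ω] (ν : Measure Ω)
    [IsProbabilityMeasure ν] (E : (Fin k ↪ Fin m) → Set Ω) (hE : ∀ S, MeasurableSet (E S)) :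
    ((locationLaw k m).prod ν).real {ω | ω.2 ∈ E ω.1} =
      (∑ S, ν.real (E S)) / Fintype.card (Fin k ↪ Fin m) := by
  have hmeas : MeasurableSet {ω : (Fin k ↪ Fin m) × Ω | ω.2 ∈ E ω.1} := by
    have : {ω : (Fin k ↪ Fin m) × Ω | ω.2 ∈ E ω.1} = ⋃ S, {S} ×ˢ E S := by
      ext ⟨S, z⟩
      simp
    rw [this]
    exact MeasurableSet.iUnion fun S =>
      (MeasurableSpace.measurableSet_top (s := {S})).prod (hE S)
  have : MeasurableSingletonClass (Fin k ↪ Fin m) := ⟨fun _ => MeasurableSpace.measurableSet_top⟩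
  rw [measureReal_def, Measure.prod_apply hmeas, locationLaw, uniformOn, ProbabilityTheory.cond,
    lintegral_smul_measure, Measure.restrict_univ, lintegral_count, tsum_fintype,
    Measure.count_apply MeasurableSet.univ]
  simp only [smul_eq_mul, ENNReal.toReal_mul, ENNReal.toReal_inv]
  rw [ENNReal.toReal_sum fun S _ => measure_ne_top _ _, div_eq_inv_mul]
  simp [measureReal_def]

lemma signal_apply {k l m : ℕ} (W : Matrix (Fin k) (Fin l) ℝ) (S : Fin k ↪ Fin m) (j : Fin k) :
    signal W S (S j) = W j := by
  ext i
  simp [signal, S.injective.eq_iff]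

lemma supp_signal {k l m : ℕ} {W : Matrix (Fin k) (Fin l) ℝ} (hW : ∀ i, ∃ j, W i j ≠ 0)
    (S : Fin k ↪ Fin m) : supp (signal W S) = Set.range S := by
  ext s
  constructor
  · rintro ⟨i, hi⟩
    by_contra hs
    refine hi (Finset.sum_eq_zero fun j _ => if_neg fun h => hs ⟨j, h.symm⟩)
  · rintro ⟨j, rfl⟩
    obtain ⟨i, hi⟩ := hW j
    exact ⟨i, by rwa [signal_apply]⟩

lemma mul_signal_apply {k l m n : ℕ} (W : Matrix (Fin k) (Fin l) ℝ) (S : Fin k ↪ Fin m)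
    (A : Matrix (Fin n) (Fin m) ℝ) (i : Fin n) (c : Fin l) :
    (A * signal W S) i c = ∑ j, A i (S j) * W j c := by
  simp only [Matrix.mul_apply, signal, Finset.mul_sum]
  rw [Finset.sum_comm]
  simp

instance isProbabilityMeasure_gaussianMatrix (n q : ℕ) (v : ℝ≥0) :
    IsProbabilityMeasure (gaussianMatrix n q v) := by
  unfold gaussianMatrix
  exact inferInstanceAs (IsProbabilityMeasure
    (Measure.pi fun _ : Fin n => Measure.pi fun _ : Fin q => gaussianReal 0 v))

/-! ### The reference covariance and its whitening matrix. -/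

section Whitening

variable {k l : ℕ} {va vz : ℝ≥0}

/-- `I + (σ_a² / σ_z²) W_Tᵀ W_T`. -/
noncomputable def noiseGain (va vz : ℝ≥0) (W : Matrix (Fin k) (Fin l) ℝ) (T : Finset (Fin k)) :
    Matrix (Fin l) (Fin l) ℝ :=
  1 + ((va : ℝ) / (vz : ℝ)) •
    ((W.submatrix (fun i : T => (i : Fin k)) id)ᵀ * W.submatrix (fun i : T => (i : Fin k)) id)

lemma posDef_noiseGain (W : Matrix (Fin k) (Fin l) ℝ) (T : Finset (Fin k)) :
    (noiseGain va vz W T).PosDef := by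
  refine Matrix.PosDef.one.add_posSemidef (Matrix.PosSemidef.smul ?_ (by positivity))
  have := Matrix.posSemidef_conjTranspose_mul_self (W.submatrix (fun i : T => (i : Fin k)) id)
  rwa [Matrix.conjTranspose_eq_transpose_of_trivial] at this

-- `L` whitens the reference rows: `L⁻¹ z` has covariance proportional to `noiseGain`. It comes from
-- factoring the positive semidefinite inverse as `star L * L`.
open scoped MatrixOrder in
lemma exists_whitening (W : Matrix (Fin k) (Fin l) ℝ) (T : Finset (Fin k)) :
    ∃ L : Matrix (Fin l) (Fin l) ℝ, L.det ≠ 0 ∧ Lᵀ * L = (noiseGain va vz W T)⁻¹ ∧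
      -Real.log |L.det| = Real.log (noiseGain va vz W T).det / 2 := by
  have hK := posDef_noiseGain (va := va) (vz := vz) W T
  have hinv : (0 : Matrix (Fin l) (Fin l) ℝ) ≤ (noiseGain va vz W T)⁻¹ :=
    Matrix.nonneg_iff_posSemidef.2 hK.inv.posSemidef
  obtain ⟨L, hL⟩ := CStarAlgebra.nonneg_iff_eq_star_mul_self.1 hinv
  rw [Matrix.star_eq_conjTranspose, Matrix.conjTranspose_eq_transpose_of_trivial] at hL
  have hdet : L.det ^ 2 = ((noiseGain va vz W T).det)⁻¹ := by
    have := congrArg Matrix.det hL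
    rw [Matrix.det_mul, Matrix.det_transpose, Matrix.det_nonsing_inv, Ring.inverse_eq_inv'] at this
    rw [sq, this]
  refine ⟨L, ?_, hL.symm, ?_⟩
  · intro h
    rw [h] at hdet
    have := inv_pos.2 hK.det_pos
    rw [← hdet] at this
    simp at this
  · have := congrArg Real.log hdet
    rw [Real.log_pow, Real.log_inv] at this
    rw [Real.log_abs]
    push_cast at this
    linarith

/-- With `K = noiseGain`, the left side is `tr(K⁻¹ W_Tᵀ W_T)`, and `W_Tᵀ W_T` is a multiple of `K -
1`. This identity is what lets the quadratic term of the divergence offset its trace term. -/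
lemma sum_sq_whitening_mulVec (hva : 0 < va) (hvz : 0 < vz) (W : Matrix (Fin k) (Fin l) ℝ)
    (T : Finset (Fin k)) {L : Matrix (Fin l) (Fin l) ℝ}
    (hL : Lᵀ * L = (noiseGain va vz W T)⁻¹) :
    ∑ r, ∑ j ∈ T, (L *ᵥ W j) r ^ 2 = (vz : ℝ) / va * (l - (Lᵀ * L).trace) := by
  have hva' : (va : ℝ) ≠ 0 := NNReal.coe_ne_zero.2 hva.ne'
  have hvz' : (vz : ℝ) ≠ 0 := NNReal.coe_ne_zero.2 hvz.ne'
  set V := W.submatrix (fun i : T => (i : Fin k)) id with hV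
  have hK := posDef_noiseGain (va := va) (vz := vz) W T
  have h1 : ∑ r, ∑ j ∈ T, (L *ᵥ W j) r ^ 2 = (L * Vᵀ * (L * Vᵀ)ᵀ).trace := by
    simp only [Matrix.trace, Matrix.diag, Matrix.mul_apply (M := L * Vᵀ), Matrix.transpose_apply]
    refine Finset.sum_congr rfl fun r _ => ?_
    rw [← Finset.sum_coe_sort]
    refine Finset.sum_congr rfl fun j _ => ?_
    rw [← sq]
    rfl
  have h2 : (L * Vᵀ * (L * Vᵀ)ᵀ).trace = (Lᵀ * L * (Vᵀ * V)).trace := by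
    rw [Matrix.transpose_mul, Matrix.transpose_transpose, ← Matrix.mul_assoc,
      Matrix.trace_mul_comm]
    simp only [Matrix.mul_assoc]
  have h3 : Vᵀ * V = ((vz : ℝ) / va) • (noiseGain va vz W T - 1) := by
    rw [noiseGain, add_sub_cancel_left, smul_smul]
    have : (vz : ℝ) / va * (va / vz) = 1 := by field_simp
    rw [this, one_smul]
  rw [h1, h2, h3, Matrix.mul_smul, Matrix.trace_smul, Matrix.mul_sub, Matrix.mul_one,
    Matrix.trace_sub, hL, Matrix.nonsing_inv_mul _ ((Matrix.isUnit_iff_isUnit_det _).1 hK.isUnit)]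
  simp

end Whitening

/-! ### Converse for a fixed measurement matrix. -/

section Converse

variable {k l n m : ℕ} {va vz : ℝ≥0}

lemma measurable_const_add_matrix (x : Matrix (Fin n) (Fin l) ℝ) :
    Measurable fun z : Matrix (Fin n) (Fin l) ℝ => x + z :=
  measurable_const_add (M := Fin n → Fin l → ℝ) x

lemma errorProbFixed_eq {W : Matrix (Fin k) (Fin l) ℝ} (hW : ∀ i, ∃ j, W i j ≠ 0)
    (A : Matrix (Fin n) (Fin m) ℝ) {d : Matrix (Fin n) (Fin l) ℝ → Set (Fin m)}
    (hd : Measurable d) :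
    errorProbFixed vz W A d =
      (∑ S : Fin k ↪ Fin m, (gaussianMatrix n l vz).real
        {z | d (A * signal W S + z) ≠ Set.range S}) / Fintype.card (Fin k ↪ Fin m) := by
  unfold errorProbFixed
  simp_rw [supp_signal hW]
  refine measureReal_locationLaw_prod (gaussianMatrix n l vz)
    (fun S => {z | d (A * signal W S + z) ≠ Set.range S}) fun S => ?_
  exact (measurable_const_add_matrix _) (hd (measurableSet_singleton (Set.range S))).compl

lemma one_sub_errorProbFixed_eq (hkm : k ≤ m) {W : Matrix (Fin k) (Fin l) ℝ}
    (hW : ∀ i, ∃ j, W i j ≠ 0) (A : Matrix (Fin n) (Fin m) ℝ)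
    {d : Matrix (Fin n) (Fin l) ℝ → Set (Fin m)} (hd : Measurable d) :
    Fintype.card (Fin k ↪ Fin m) * (1 - errorProbFixed vz W A d) =
      ∑ S : Fin k ↪ Fin m, (gaussianMatrix n l vz).real
        {z | d (A * signal W S + z) = Set.range S} := by
  have : Nonempty (Fin k ↪ Fin m) := ⟨Fin.castLEEmb hkm⟩
  have hN : (Fintype.card (Fin k ↪ Fin m) : ℝ) ≠ 0 := by exact_mod_cast Fintype.card_ne_zero
  have h : ∀ S : Fin k ↪ Fin m, (gaussianMatrix n l vz).real
      {z | d (A * signal W S + z) = Set.range S} = 1 - (gaussianMatrix n l vz).real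
        {z | d (A * signal W S + z) ≠ Set.range S} := by
    intro S
    rw [← probReal_compl_eq_one_sub]
    · congr 1
      ext z
      simp
    · exact (measurable_const_add_matrix _) (hd (measurableSet_singleton (Set.range S))).compl
  simp_rw [h]
  rw [errorProbFixed_eq hW A hd, Finset.sum_sub_distrib, mul_sub, mul_div_cancel₀ _ hN]
  simp

/-- The conditional mean of the measurements given the locations outside `T`, up to the effect of
sampling without replacement. -/
noncomputable def genieMean (W : Matrix (Fin k) (Fin l) ℝ) (T : Finset (Fin k))
    (A : Matrix (Fin n) (Fin m) ℝ) (S : Fin k ↪ Fin m) (i : Fin n) (c : Fin l) : ℝ :=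
  ∑ j ∈ Tᶜ, A i (S j) * W j c + ∑ j ∈ T, (∑ p, A i p) / m * W j c

lemma mul_signal_sub_genieMean (W : Matrix (Fin k) (Fin l) ℝ) (T : Finset (Fin k))
    (A : Matrix (Fin n) (Fin m) ℝ) (S : Fin k ↪ Fin m) (i : Fin n) :
    (A * signal W S) i - genieMean W T A S i =
      ∑ j ∈ T, (A i (S j) - (∑ p, A i p) / m) • W j := by
  ext c
  rw [Pi.sub_apply, mul_signal_apply, genieMean, ← Finset.sum_add_sum_compl T, Finset.sum_apply]
  simp only [Pi.smul_apply, smul_eq_mul, sub_mul, Finset.sum_sub_distrib]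
  ring

/-- Each whitened coordinate is a linear statistic of centred entries of a row of `A` sampled
without replacement, so the variance bound applies; centring only decreases the row energy. -/
lemma sum_sq_whitening_sub_genieMean_le (hm : 1 < m) (hva : 0 < va) (hvz : 0 < vz)
    (W : Matrix (Fin k) (Fin l) ℝ) (T : Finset (Fin k)) (A : Matrix (Fin n) (Fin m) ℝ)
    {L : Matrix (Fin l) (Fin l) ℝ} (hL : Lᵀ * L = (noiseGain va vz W T)⁻¹) :
    ∑ S : Fin k ↪ Fin m, ∑ i, ∑ r, (L *ᵥ ((A * signal W S) i - genieMean W T A S i)) r ^ 2 ≤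
      Fintype.card (Fin k ↪ Fin m) *
        ((vz : ℝ) / va * (l - (Lᵀ * L).trace) * (∑ i, ∑ p, A i p ^ 2) / (m - 1)) := by
  have : Nonempty (Fin m) := ⟨⟨0, by omega⟩⟩
  have hm1 : (0 : ℝ) < m - 1 := by
    have : (1 : ℝ) < m := by exact_mod_cast hm
    linarith
  set N : ℝ := (Fintype.card (Fin k ↪ Fin m) : ℝ) with hN
  have hexp : ∀ (S : Fin k ↪ Fin m) i r,
      (L *ᵥ ((A * signal W S) i - genieMean W T A S i)) r =
        ∑ j ∈ T, (L *ᵥ W j) r * (A i (S j) - (∑ p, A i p) / m) := by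
    intro S i r
    rw [mul_signal_sub_genieMean, Matrix.mulVec_sum, Finset.sum_apply]
    refine Finset.sum_congr rfl fun j _ => ?_
    rw [Matrix.mulVec_smul, Pi.smul_apply, smul_eq_mul, mul_comm]
  have hrow : ∀ i r, ∑ S : Fin k ↪ Fin m,
      (L *ᵥ ((A * signal W S) i - genieMean W T A S i)) r ^ 2 ≤
        N * ((∑ j ∈ T, (L *ᵥ W j) r ^ 2) * (∑ p, A i p ^ 2) / (m - 1)) := by
    intro i r
    simp_rw [hexp]
    have hg : ∑ p : Fin m, (A i p - (∑ p, A i p) / m) = 0 := by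
      have : (m : ℝ) ≠ 0 := by linarith
      rw [Finset.sum_sub_distrib]
      simp
      field_simp
      ring
    have h1 := sum_embedding_sq_le (by simpa using hm) (fun p => A i p - (∑ p, A i p) / m) hg T
      (fun j => (L *ᵥ W j) r)
    have h2 := sum_sub_mean_sq_le (fun p => A i p)
    simp only [Fintype.card_fin] at h1 h2
    refine h1.trans ?_
    have : 0 ≤ ∑ j ∈ T, (L *ᵥ W j) r ^ 2 := Finset.sum_nonneg fun _ _ => sq_nonneg _
    gcongr
  have hswap : ∑ S : Fin k ↪ Fin m, ∑ i, ∑ r,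
      (L *ᵥ ((A * signal W S) i - genieMean W T A S i)) r ^ 2 =
      ∑ i, ∑ r, ∑ S : Fin k ↪ Fin m,
        (L *ᵥ ((A * signal W S) i - genieMean W T A S i)) r ^ 2 := by
    rw [Finset.sum_comm]
    exact Finset.sum_congr rfl fun i _ => Finset.sum_comm
  rw [hswap, ← sum_sq_whitening_mulVec hva hvz W T hL]
  refine (Finset.sum_le_sum fun i _ => Finset.sum_le_sum fun r _ => hrow i r).trans (le_of_eq ?_)
  simp_rw [← Finset.mul_sum, ← Finset.sum_div, ← Finset.sum_mul, ← Finset.mul_sum]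

/-- Under the reference laws a decoder can only guess the entries in `T`. The counting bound holds
pointwise in `y` with `B = d y` and is then integrated. -/
lemma sum_setIntegral_genie_le (hk : 0 < k) (hkm : k ≤ m) (hvz : 0 < vz)
    (W : Matrix (Fin k) (Fin l) ℝ) (T : Finset (Fin k)) (A : Matrix (Fin n) (Fin m) ℝ)
    {L : Matrix (Fin l) (Fin l) ℝ} (hL : L.det ≠ 0)
    {d : (Fin n → Fin l → ℝ) → Set (Fin m)} (hd : Measurable d) :
    ((m - k + 1 : ℕ) : ℝ) ^ T.card / (k : ℝ) ^ k * ∑ S : Fin k ↪ Fin m,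
      ∫ y : Fin n → Fin l → ℝ in {y : Fin n → Fin l → ℝ | d y = Set.range S},
        rowsDensity (transformedDensity L vz) (y - genieMean W T A S) ≤
      Fintype.card (Fin k ↪ Fin m) := by
  classical
  have hE : ∀ S : Fin k ↪ Fin m,
      MeasurableSet {y : Fin n → Fin l → ℝ | d y = Set.range S} :=
    fun S => hd (measurableSet_singleton (Set.range S))
  have hQi : Integrable (rowsDensity (κ := Fin n) (transformedDensity L vz)) :=
    integrable_rowsDensity (integrable_transformedDensity hL vz)
  have hQi' : ∀ S : Fin k ↪ Fin m, Integrable fun y : Fin n → Fin l → ℝ =>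
      rowsDensity (transformedDensity L vz) (y - genieMean W T A S) :=
    fun S => hQi.comp_sub_right _
  have hQ1 : ∀ S : Fin k ↪ Fin m, ∫ y : Fin n → Fin l → ℝ,
      rowsDensity (transformedDensity L vz) (y - genieMean W T A S) = 1 := fun S => by
    rw [integral_sub_right_eq_self]
    exact integral_rowsDensity (integral_transformedDensity hL hvz)
  have hk0 : (0 : ℝ) < (k : ℝ) ^ k := by positivity
  have hsum : ∑ S : Fin k ↪ Fin m,
      ∫ y : Fin n → Fin l → ℝ in {y : Fin n → Fin l → ℝ | d y = Set.range S},
        rowsDensity (transformedDensity L vz) (y - genieMean W T A S) =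
      ∫ y : Fin n → Fin l → ℝ, ∑ S : Fin k ↪ Fin m, if Set.range S = d y then
        rowsDensity (transformedDensity L vz) (y - genieMean W T A S) else 0 := by
    rw [integral_finsetSum]
    · refine Finset.sum_congr rfl fun S _ => ?_
      rw [← integral_indicator (hE S)]
      refine integral_congr_ae (ae_of_all _ fun y => ?_)
      simp only [Set.indicator_apply, Set.mem_ofPred_eq, eq_comm]
    · intro S _
      refine ((hQi' S).indicator (hE S)).congr (ae_of_all _ fun y => ?_)
      simp only [Set.indicator_apply, Set.mem_ofPred_eq, eq_comm]
  rw [hsum, div_mul_eq_mul_div, div_le_iff₀ hk0, ← integral_const_mul]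
  have hR : (Fintype.card (Fin k ↪ Fin m) : ℝ) * (k : ℝ) ^ k =
      ∫ y : Fin n → Fin l → ℝ, (k : ℝ) ^ k * ∑ S : Fin k ↪ Fin m,
        rowsDensity (transformedDensity L vz) (y - genieMean W T A S) := by
    rw [integral_const_mul, integral_finsetSum _ fun S _ => hQi' S]
    simp_rw [hQ1]
    simp [mul_comm]
  rw [hR]
  refine integral_mono_of_nonneg (ae_of_all _ fun y => ?_)
    ((integrable_finsetSum _ fun S _ => hQi' S).const_mul _) (ae_of_all _ fun y => ?_)
  · refine mul_nonneg (by positivity) (Finset.sum_nonneg fun S _ => ?_)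
    split_ifs
    · exact (rowsDensity_pos (transformedDensity_pos hL hvz) _).le
    · exact le_rfl
  · refine pow_mul_sum_range_eq_le hkm T (d y)
      (fun S => rowsDensity (transformedDensity L vz) (y - genieMean W T A S))
      (fun S => (rowsDensity_pos (transformedDensity_pos hL hvz) _).le) fun S S' h => ?_
    have : genieMean W T A S' = genieMean W T A S := by
      ext i c
      simp only [genieMean]
      congr 1
      exact Finset.sum_congr rfl fun j hj => by rw [h j (Finset.mem_compl.1 hj)]
    simp only [this]

/-- The Fano-type converse for a fixed measurement matrix. -/
lemma one_sub_errorProbFixed_mul_log_le (hk : 0 < k) (hkm : k ≤ m) (hm : 1 < m) (hva : 0 < va)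
    (hvz : 0 < vz) {W : Matrix (Fin k) (Fin l) ℝ} (hW : ∀ i, ∃ j, W i j ≠ 0)
    (T : Finset (Fin k)) (A : Matrix (Fin n) (Fin m) ℝ)
    {d : Matrix (Fin n) (Fin l) ℝ → Set (Fin m)} (hd : Measurable d) :
    (1 - errorProbFixed vz W A d) *
        Real.log (((m - k + 1 : ℕ) : ℝ) ^ T.card / (k : ℝ) ^ k) ≤
      1 + n * (Real.log (noiseGain va vz W T).det / 2) +
        (l - ((noiseGain va vz W T)⁻¹).trace) / 2 *
          ((∑ i, ∑ p, A i p ^ 2) / ((m - 1) * va) - n) := by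
  obtain ⟨L, hL, hLK, hdet⟩ := exists_whitening (va := va) (vz := vz) W T
  have : Nonempty (Fin k ↪ Fin m) := ⟨Fin.castLEEmb hkm⟩
  have hN : (0 : ℝ) < Fintype.card (Fin k ↪ Fin m) := by exact_mod_cast Fintype.card_pos
  have hva' : (va : ℝ) ≠ 0 := NNReal.coe_ne_zero.2 hva.ne'
  have hvz' : (vz : ℝ) ≠ 0 := NNReal.coe_ne_zero.2 hvz.ne'
  have hm1 : (m : ℝ) - 1 ≠ 0 := by
    have : (1 : ℝ) < m := by exact_mod_cast hm
    linarith
  have hM : (0 : ℝ) < ((m - k + 1 : ℕ) : ℝ) ^ T.card / (k : ℝ) ^ k := by positivity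
  set M := ((m - k + 1 : ℕ) : ℝ) ^ T.card / (k : ℝ) ^ k with hMdef
  have hS : ∀ S : Fin k ↪ Fin m, Real.log M * (gaussianMatrix n l vz).real
      {z | d (A * signal W S + z) = Set.range S} ≤
      ∑ i, rowDivergence L vz ((A * signal W S) i - genieMean W T A S i) +
        M * ∫ y : Fin n → Fin l → ℝ in {y : Fin n → Fin l → ℝ | d y = Set.range S},
          rowsDensity (transformedDensity L vz) (y - genieMean W T A S) := by
    intro S
    -- The choice `c = log M` makes `exp c` cancel the guessing probability, leaving the summand `1`
    -- in the final bound.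
    have := mul_measureReal_le_sum_rowDivergence_add hL hvz (A * signal W S)
      (genieMean W T A S) (hd (measurableSet_singleton (Set.range S))) (Real.log M)
    rw [Real.exp_log hM] at this
    exact this
  have hsum := Finset.sum_le_sum fun S (_ : S ∈ Finset.univ) => hS S
  rw [← Finset.mul_sum, ← one_sub_errorProbFixed_eq hkm hW A hd, Finset.sum_add_distrib,
    ← Finset.mul_sum] at hsum
  have hgenie := sum_setIntegral_genie_le hk hkm hvz W T A hL hd
  have hquad := sum_sq_whitening_sub_genieMean_le hm hva hvz W T A hLK
  have hdiv : ∑ S : Fin k ↪ Fin m, ∑ i,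
      rowDivergence L vz ((A * signal W S) i - genieMean W T A S i) =
      Fintype.card (Fin k ↪ Fin m) * (n * (Real.log (noiseGain va vz W T).det / 2
        - (l - (Lᵀ * L).trace) / 2)) +
      (∑ S : Fin k ↪ Fin m, ∑ i, ∑ r,
        (L *ᵥ ((A * signal W S) i - genieMean W T A S i)) r ^ 2) / (2 * vz) := by
    simp only [rowDivergence, hdet, Finset.sum_add_distrib, Finset.sum_sub_distrib,
      Finset.sum_const, Finset.card_univ, Fintype.card_fin, nsmul_eq_mul, ← Finset.sum_div]
    ring
  rw [hdiv] at hsum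
  rw [← hLK]
  refine le_of_mul_le_mul_left ?_ hN
  have hq2 := div_le_div_of_nonneg_right hquad (by positivity : (0 : ℝ) ≤ 2 * vz)
  have e : (Fintype.card (Fin k ↪ Fin m) : ℝ) *
        ((vz : ℝ) / va * (l - (Lᵀ * L).trace) * (∑ i, ∑ p, A i p ^ 2) / (m - 1)) / (2 * vz) =
      Fintype.card (Fin k ↪ Fin m) * ((l - (Lᵀ * L).trace) / 2 *
        ((∑ i, ∑ p, A i p ^ 2) / ((m - 1) * va))) := by
    field_simp
  rw [e] at hq2
  linarith

/-- Up to the positive factor `vz / va`, this quantity is the sum of squares in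
`sum_sq_whitening_mulVec`. -/
lemma trace_inv_noiseGain_le (hva : 0 < va) (hvz : 0 < vz) (W : Matrix (Fin k) (Fin l) ℝ)
    (T : Finset (Fin k)) : 0 ≤ l - ((noiseGain va vz W T)⁻¹).trace := by
  obtain ⟨L, -, hLK, -⟩ := exists_whitening (va := va) (vz := vz) W T
  have h := sum_sq_whitening_mulVec hva hvz W T hLK
  have h0 : 0 ≤ ∑ r, ∑ j ∈ T, (L *ᵥ W j) r ^ 2 :=
    Finset.sum_nonneg fun _ _ => Finset.sum_nonneg fun _ _ => sq_nonneg _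
  rw [h, hLK] at h0
  have : (0 : ℝ) < (vz : ℝ) / va := div_pos hvz hva
  exact nonneg_of_mul_nonneg_right h0 this

/-- Nonnegativity of the divergence at equal means bounds the log-determinant below by `l - tr K⁻¹ ≥
0`. -/
lemma log_det_noiseGain_nonneg (hva : 0 < va) (hvz : 0 < vz) (W : Matrix (Fin k) (Fin l) ℝ)
    (T : Finset (Fin k)) : 0 ≤ Real.log (noiseGain va vz W T).det := by
  obtain ⟨L, hL, hLK, hdet⟩ := exists_whitening (va := va) (vz := vz) W T
  have h := rowDivergence_zero_nonneg hL hvz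
  have h2 := trace_inv_noiseGain_le hva hvz W T
  simp only [rowDivergence, hdet, hLK] at h
  simp at h
  linarith

end Converse

lemma isProbabilityMeasure_locationLaw (k m : ℕ) [Nonempty (Fin k ↪ Fin m)] :
    IsProbabilityMeasure (locationLaw k m) := by
  have : MeasurableSingletonClass (Fin k ↪ Fin m) := ⟨fun _ => MeasurableSpace.measurableSet_top⟩
  exact isProbabilityMeasure_uniformOn Set.finite_univ Set.univ_nonempty

/-! ### Converse for Gaussian measurement matrices. -/

section GaussianMeasurements

variable {k l n m : ℕ} {va vz : ℝ≥0}

/-- The case `k > m`, where the sample space is empty, is included because the limits are taken over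
sequences bounded at every index. -/
lemma errorProbGaussian_le_one (W : Matrix (Fin k) (Fin l) ℝ)
    (d : Matrix (Fin n) (Fin m) ℝ → Matrix (Fin n) (Fin l) ℝ → Set (Fin m)) :
    errorProbGaussian va vz W d ≤ 1 := by
  rcases isEmpty_or_nonempty (Fin k ↪ Fin m) with h | h
  · unfold errorProbGaussian
    rw [Set.eq_empty_of_isEmpty {ω | _}]
    simp
  · have := isProbabilityMeasure_locationLaw k m
    exact measureReal_le_one

lemma measurable_observation (X : Matrix (Fin m) (Fin l) ℝ) :
    Measurable fun ω : Matrix (Fin n) (Fin m) ℝ × Matrix (Fin n) (Fin l) ℝ =>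
      (ω.1, ω.1 * X + ω.2) := by
  have h : Measurable fun ω : (Fin n → Fin m → ℝ) × (Fin n → Fin l → ℝ) =>
      (ω.1, fun i c => (∑ p, ω.1 i p * X p c) + ω.2 i c) := by fun_prop
  exact h

lemma measurableSet_error {d : Matrix (Fin n) (Fin m) ℝ → Matrix (Fin n) (Fin l) ℝ → Set (Fin m)}
    (hd : Measurable (Function.uncurry d)) (X : Matrix (Fin m) (Fin l) ℝ) (B : Set (Fin m)) :
    MeasurableSet {ω : Matrix (Fin n) (Fin m) ℝ × Matrix (Fin n) (Fin l) ℝ |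
      d ω.1 (ω.1 * X + ω.2) ≠ B} :=
  ((hd.comp (measurable_observation X)) (measurableSet_singleton B)).compl

lemma measurable_measureReal_error
    {d : Matrix (Fin n) (Fin m) ℝ → Matrix (Fin n) (Fin l) ℝ → Set (Fin m)}
    (hd : Measurable (Function.uncurry d)) (X : Matrix (Fin m) (Fin l) ℝ) (B : Set (Fin m)) :
    Measurable fun A => (gaussianMatrix n l vz).real {z | d A (A * X + z) ≠ B} :=
  (measurable_measure_prodMk_left (measurableSet_error hd X B)).ennreal_toReal

lemma integrable_measureReal_error
    {d : Matrix (Fin n) (Fin m) ℝ → Matrix (Fin n) (Fin l) ℝ → Set (Fin m)}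
    (hd : Measurable (Function.uncurry d)) (X : Matrix (Fin m) (Fin l) ℝ) (B : Set (Fin m)) :
    Integrable (fun A => (gaussianMatrix n l vz).real {z | d A (A * X + z) ≠ B})
      (gaussianMatrix n m va) := by
  refine Integrable.of_bound (measurable_measureReal_error hd X B).aestronglyMeasurable 1
    (ae_of_all _ fun A => ?_)
  rw [Real.norm_of_nonneg measureReal_nonneg]
  exact measureReal_le_one

lemma errorProbFixed_uncurry_eq {W : Matrix (Fin k) (Fin l) ℝ} (hW : ∀ i, ∃ j, W i j ≠ 0)
    {d : Matrix (Fin n) (Fin m) ℝ → Matrix (Fin n) (Fin l) ℝ → Set (Fin m)}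
    (hd : Measurable (Function.uncurry d)) :
    (fun A => errorProbFixed vz W A (d A)) = fun A =>
      (∑ S : Fin k ↪ Fin m, (gaussianMatrix n l vz).real
        {z | d A (A * signal W S + z) ≠ Set.range S}) / Fintype.card (Fin k ↪ Fin m) :=
  funext fun A => errorProbFixed_eq hW A (hd.comp measurable_prodMk_left)

lemma integrable_errorProbFixed {W : Matrix (Fin k) (Fin l) ℝ} (hW : ∀ i, ∃ j, W i j ≠ 0)
    {d : Matrix (Fin n) (Fin m) ℝ → Matrix (Fin n) (Fin l) ℝ → Set (Fin m)}
    (hd : Measurable (Function.uncurry d)) :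
    Integrable (fun A => errorProbFixed vz W A (d A)) (gaussianMatrix n m va) := by
  rw [errorProbFixed_uncurry_eq hW hd]
  exact (integrable_finsetSum _ fun S _ => integrable_measureReal_error hd _ _).div_const _

/-- The error probability with Gaussian measurements averages the error probabilities of the
realizations of the measurement matrix. -/
lemma errorProbGaussian_eq_integral {W : Matrix (Fin k) (Fin l) ℝ} (hW : ∀ i, ∃ j, W i j ≠ 0)
    {d : Matrix (Fin n) (Fin m) ℝ → Matrix (Fin n) (Fin l) ℝ → Set (Fin m)}
    (hd : Measurable (Function.uncurry d)) :
    errorProbGaussian va vz W d =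
      ∫ A, errorProbFixed vz W A (d A) ∂(gaussianMatrix n m va) := by
  rw [errorProbFixed_uncurry_eq hW hd, integral_div,
    integral_finsetSum _ fun S _ => integrable_measureReal_error hd _ _]
  unfold errorProbGaussian
  simp_rw [supp_signal hW]
  refine (measureReal_locationLaw_prod ((gaussianMatrix n m va).prod (gaussianMatrix n l vz))
    (fun S => {ω | d ω.1 (ω.1 * signal W S + ω.2) ≠ Set.range S})
    fun S => measurableSet_error hd _ _).trans ?_
  congr 1
  refine Finset.sum_congr rfl fun S _ => ?_
  rw [measureReal_def, Measure.prod_apply (measurableSet_error hd _ _), ← integral_toReal]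
  · rfl
  · exact (measurable_measure_prodMk_left (measurableSet_error hd _ _)).aemeasurable
  · exact ae_of_all _ fun A => measure_lt_top _ _

lemma integrable_sq_entry (i : Fin n) (p : Fin m) :
    Integrable (fun A : Matrix (Fin n) (Fin m) ℝ => A i p ^ 2) (gaussianMatrix n m va) :=
  integrable_comp_eval (μ := fun _ : Fin n => Measure.pi fun _ : Fin m => gaussianReal 0 va)
    (integrable_sq_eval va p)

lemma integral_sq_entry (i : Fin n) (p : Fin m) :
    ∫ A, A i p ^ 2 ∂(gaussianMatrix n m va) = va := by
  have := integral_comp_eval (i := i)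
    (μ := fun _ : Fin n => Measure.pi fun _ : Fin m => gaussianReal 0 va)
    (integrable_sq_eval va p).aestronglyMeasurable
  rw [integral_sq_eval] at this
  exact this

/-- The Fano-type converse for Gaussian measurement matrices. -/
lemma one_sub_errorProbGaussian_mul_log_le (hk : 0 < k) (hkm : k ≤ m) (hm : 1 < m) (hva : 0 < va)
    (hvz : 0 < vz) {W : Matrix (Fin k) (Fin l) ℝ} (hW : ∀ i, ∃ j, W i j ≠ 0)
    (T : Finset (Fin k))
    {d : Matrix (Fin n) (Fin m) ℝ → Matrix (Fin n) (Fin l) ℝ → Set (Fin m)}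
    (hd : Measurable (Function.uncurry d)) :
    (1 - errorProbGaussian va vz W d) *
        Real.log (((m - k + 1 : ℕ) : ℝ) ^ T.card / (k : ℝ) ^ k) ≤
      1 + n * (Real.log (noiseGain va vz W T).det / 2) +
        (l - ((noiseGain va vz W T)⁻¹).trace) / 2 * (n / (m - 1)) := by
  have hva' : (va : ℝ) ≠ 0 := NNReal.coe_ne_zero.2 hva.ne'
  have hm1 : (m : ℝ) - 1 ≠ 0 := by
    have : (1 : ℝ) < m := by exact_mod_cast hm
    linarith
  set c := Real.log (((m - k + 1 : ℕ) : ℝ) ^ T.card / (k : ℝ) ^ k)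
  set a := 1 + n * (Real.log (noiseGain va vz W T).det / 2)
  set τ := (l - ((noiseGain va vz W T)⁻¹).trace) / 2
  have i1 : Integrable (fun A : Matrix (Fin n) (Fin m) ℝ => ∑ i, ∑ p, A i p ^ 2)
      (gaussianMatrix n m va) :=
    integrable_finsetSum _ fun i _ => integrable_finsetSum _ fun p _ => integrable_sq_entry i p
  have i2 := integrable_errorProbFixed (va := va) (vz := vz) hW hd
  have hsq : ∫ A : Matrix (Fin n) (Fin m) ℝ, ∑ i, ∑ p, A i p ^ 2 ∂(gaussianMatrix n m va) =
      n * (m * va) := by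
    rw [integral_finsetSum _ fun i _ => integrable_finsetSum _ fun p _ => integrable_sq_entry i p]
    simp_rw [integral_finsetSum _ fun p _ => integrable_sq_entry _ p, integral_sq_entry]
    simp
  have i3 : Integrable (fun A => (1 - errorProbFixed vz W A (d A)) * c) (gaussianMatrix n m va) :=
    ((integrable_const 1).sub i2).mul_const c
  have i4 : Integrable (fun A : Matrix (Fin n) (Fin m) ℝ =>
      (∑ i, ∑ p, A i p ^ 2) / ((m - 1) * (va : ℝ))) (gaussianMatrix n m va) := i1.div_const _
  have i5 : Integrable (fun A : Matrix (Fin n) (Fin m) ℝ =>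
      τ * ((∑ i, ∑ p, A i p ^ 2) / ((m - 1) * (va : ℝ)) - n)) (gaussianMatrix n m va) :=
    (i4.sub (integrable_const _)).const_mul τ
  -- The fixed-matrix bound is affine in the error probability and in `‖A‖_F²`, whose mean is
  -- exactly `n m va`; the surplus `n m/(m-1) - n` equals `n/(m-1)`.
  have hmono := integral_mono i3 ((integrable_const a).add i5) fun A =>
    one_sub_errorProbFixed_mul_log_le hk hkm hm hva hvz hW T A
      (d := d A) (hd.comp measurable_prodMk_left)
  have e1 : ∫ A, (1 - errorProbFixed vz W A (d A)) * c ∂(gaussianMatrix n m va) =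
      (1 - errorProbGaussian va vz W d) * c := by
    rw [integral_mul_const, integral_sub (integrable_const 1) i2,
      ← errorProbGaussian_eq_integral hW hd]
    simp
  have e2 : ∫ A : Matrix (Fin n) (Fin m) ℝ,
      (a + τ * ((∑ i, ∑ p, A i p ^ 2) / ((m - 1) * (va : ℝ)) - n)) ∂(gaussianMatrix n m va) =
      a + τ * (n / (m - 1)) := by
    rw [integral_add (integrable_const a) i5, integral_const_mul,
      integral_sub i4 (integrable_const _), integral_div, hsq]
    simp
    left
    field_simp
    ring
  rw [e1] at hmono
  exact hmono.trans_eq e2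

end GaussianMeasurements

/-! ### From the finite bound to rates above capacity. -/

section Asymptotics

/-- The converse bound keeps the error probability away from zero above capacity. -/
lemma exists_pos_eventually_le {k t : ℕ} (hk : 0 < k) (ht : 0 < t) {c r τ : ℝ} (hc : 0 ≤ c)
    (hcr : c < r) :
    ∃ η : ℝ, 0 < η ∧ ∀ᶠ m : ℕ in atTop, ∀ (n : ℕ) (P : ℝ), 0 < n → 0 ≤ P → P ≤ 1 →
      r < Real.log m / n →
      (1 - P) * Real.log (((m - k + 1 : ℕ) : ℝ) ^ t / (k : ℝ) ^ k) ≤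
        1 + n * (t * c) + τ * (n / (m - 1)) → η ≤ P := by
  obtain ⟨ε, hε, rfl⟩ : ∃ ε : ℝ, 0 < ε ∧ r = c + ε := ⟨r - c, by linarith, by ring⟩
  have hce : 0 < c + ε := by linarith
  have ht' : (0 : ℝ) < t := by exact_mod_cast ht
  have hk' : (1 : ℝ) ≤ k := by exact_mod_cast hk
  set C : ℝ := t * Real.log 2 + k * Real.log k with hC
  have hC0 : 0 ≤ C := by
    have := Real.log_nonneg hk'
    have := Real.log_nonneg one_le_two
    positivity
  -- The target is `(1 - P)(c + ε) ≤ c + ε/2`. Half of the gap `ε` is spent: one quarter absorbs the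
  -- constants `1 + C`, another the `τ` term. The threshold on `m` is uniform in `n` and `P`.
  refine ⟨ε / 2 / (c + ε), by positivity, ?_⟩
  have hlog : Tendsto (fun m : ℕ => Real.log m) atTop atTop :=
    Real.tendsto_log_atTop.comp tendsto_natCast_atTop_atTop
  have e1 : ∀ᶠ m : ℕ in atTop, (1 + C) * (c + ε) / (t * (ε / 4)) ≤ Real.log m :=
    hlog.eventually_ge_atTop _
  have e2 : ∀ᶠ m : ℕ in atTop, τ / (t * (ε / 4)) + 1 ≤ (m : ℝ) :=
    tendsto_natCast_atTop_atTop.eventually_ge_atTop _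
  filter_upwards [e1, e2, eventually_ge_atTop (2 * k), eventually_gt_atTop 1]
    with m h1 h2 h3 h4 n P hn hP0 hP1 hr hb
  have hm1 : (0 : ℝ) < m - 1 := by
    have : (1 : ℝ) < m := by exact_mod_cast h4
    linarith
  have hm0 : (0 : ℝ) < m := by linarith
  have hn' : (0 : ℝ) < n := by exact_mod_cast hn
  set ρ := Real.log m with hρ
  have hM : t * ρ - C ≤ Real.log (((m - k + 1 : ℕ) : ℝ) ^ t / (k : ℝ) ^ k) := by
    -- Halving `m` costs `t log 2` and the factor `k ^ k` costs `k log k`; these make up `C`.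
    have hhalf : (m : ℝ) / 2 ≤ ((m - k + 1 : ℕ) : ℝ) := by
      have : m ≤ (m - k + 1) * 2 := by omega
      rw [div_le_iff₀ two_pos]
      exact_mod_cast this
    have := Real.log_le_log (by positivity) hhalf
    rw [Real.log_div hm0.ne' two_ne_zero] at this
    rw [Real.log_div (by positivity) (by positivity), Real.log_pow, Real.log_pow]
    have := mul_le_mul_of_nonneg_left this ht'.le
    rw [hC]
    linarith
  rw [lt_div_iff₀ hn'] at hr
  have hτ : τ / (m - 1) ≤ t * (ε / 4) := by
    rw [div_le_iff₀ hm1, mul_comm, ← div_le_iff₀ (by positivity)]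
    linarith
  have hτn : τ * (n / (m - 1)) ≤ n * (t * (ε / 4)) := by
    have := mul_le_mul_of_nonneg_left hτ hn'.le
    calc τ * (n / (m - 1)) = n * (τ / (m - 1)) := by ring
      _ ≤ _ := this
  have h1' : (1 + C) * (c + ε) ≤ ρ * (t * (ε / 4)) := by
    rwa [div_le_iff₀ (by positivity)] at h1
  have hPM : (1 - P) * (t * ρ - C) ≤ 1 + n * (t * (c + ε / 4)) := by
    have := mul_le_mul_of_nonneg_left hM (by linarith : 0 ≤ 1 - P)
    linarith
  have hPρ : (1 - P) * (t * ρ) ≤ 1 + C + n * (t * (c + ε / 4)) := by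
    have : 0 ≤ P * C := mul_nonneg hP0 hC0
    linarith
  have hρ0 : 0 < ρ := lt_trans (mul_pos hce hn') hr
  -- The rate assumption enters as `(c + ε) n < log m`, which trades `n` for `log m`.
  have hnb : n * (t * (c + ε / 4)) * (c + ε) ≤ ρ * (t * (c + ε / 4)) := by
    have := mul_le_mul_of_nonneg_right hr.le (by positivity : 0 ≤ (t : ℝ) * (c + ε / 4))
    linarith
  have hmul := mul_le_mul_of_nonneg_right hPρ hce.le
  have hfin : (t * ρ) * ((1 - P) * (c + ε)) ≤ (t * ρ) * (c + ε / 2) := by linarith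
  have := le_of_mul_le_mul_left hfin (by positivity)
  rw [div_le_iff₀ hce]
  linarith

variable {k l : ℕ} {va vz : ℝ≥0}

lemma exists_capacity_eq (hk : 0 < k) (va vz : ℝ≥0) (W : Matrix (Fin k) (Fin l) ℝ) :
    ∃ T : Finset (Fin k), 0 < T.card ∧
      T.card * capacity va vz W = Real.log (noiseGain va vz W T).det / 2 := by
  have : Nonempty {T : Finset (Fin k) // T.Nonempty} := ⟨⟨{⟨0, hk⟩}, Finset.singleton_nonempty _⟩⟩
  obtain ⟨T, hT⟩ := exists_eq_ciInf_of_finite (f := fun T : {T : Finset (Fin k) // T.Nonempty} =>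
    1 / (2 * (T.1.card : ℝ)) * Real.log (noiseGain va vz W T.1).det)
  refine ⟨T.1, T.2.card_pos, ?_⟩
  have hT' : capacity va vz W =
      1 / (2 * (T.1.card : ℝ)) * Real.log (noiseGain va vz W T.1).det := hT.symm
  have : (T.1.card : ℝ) ≠ 0 := by exact_mod_cast T.2.card_pos.ne'
  rw [hT']
  field_simp

lemma capacity_nonneg (hk : 0 < k) (hva : 0 < va) (hvz : 0 < vz)
    (W : Matrix (Fin k) (Fin l) ℝ) : 0 ≤ capacity va vz W := by
  obtain ⟨T, hT, h⟩ := exists_capacity_eq hk va vz W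
  have h0 := log_det_noiseGain_nonneg hva hvz W T
  have hT' : (0 : ℝ) < T.card := by exact_mod_cast hT
  refine nonneg_of_mul_nonneg_right ?_ hT'
  rw [h]
  positivity

/-- Above capacity, the Gaussian and the power-constrained error probabilities are bounded away
from zero. -/
lemma exists_pos_eventually_le_errorProb (hk : 0 < k) (hva : 0 < va) (hvz : 0 < vz)
    {W : Matrix (Fin k) (Fin l) ℝ} (hW : ∀ i, ∃ j, W i j ≠ 0) {n : ℕ → ℕ}
    (hn : ∀ m, k ≤ m → 0 < n m) {x : EReal} (hx : (capacity va vz W : EReal) < x) :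
    ∃ r : EReal, r < x ∧ ∃ η : ℝ, 0 < η ∧ ∀ᶠ m in atTop, r < rate n m →
      (∀ d : Matrix (Fin (n m)) (Fin m) ℝ → Matrix (Fin (n m)) (Fin l) ℝ → Set (Fin m),
        Measurable (Function.uncurry d) → η ≤ errorProbGaussian va vz W d) ∧
      (∀ (A : Matrix (Fin (n m)) (Fin m) ℝ) (d : Matrix (Fin (n m)) (Fin l) ℝ → Set (Fin m)),
        avgPower A ≤ va → Measurable d → η ≤ errorProbFixed vz W A d) := by
  -- A real `r` strictly between leaves a fixed gap above capacity and also handles an infinite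
  -- upper limit.
  obtain ⟨r, hcr, hrx⟩ := EReal.lt_iff_exists_real_btwn.1 hx
  rw [EReal.coe_lt_coe_iff] at hcr
  obtain ⟨T, hT, hTc⟩ := exists_capacity_eq hk va vz W
  set τ := (l - ((noiseGain va vz W T)⁻¹).trace) / 2 with hτ
  have hτ0 : 0 ≤ τ := by
    have := trace_inv_noiseGain_le hva hvz W T
    positivity
  obtain ⟨η, hη, hev⟩ := exists_pos_eventually_le (τ := τ) hk hT (capacity_nonneg hk hva hvz W) hcr
  refine ⟨r, hrx, η, hη, ?_⟩
  filter_upwards [hev, eventually_ge_atTop k, eventually_gt_atTop 1] with m hm hkm hm1 hr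
  rw [rate, EReal.coe_lt_coe_iff] at hr
  have : Nonempty (Fin k ↪ Fin m) := ⟨Fin.castLEEmb hkm⟩
  have := isProbabilityMeasure_locationLaw k m
  have hva' : (0 : ℝ) < va := hva
  have hm1' : (0 : ℝ) < m - 1 := by
    have : (1 : ℝ) < m := by exact_mod_cast hm1
    linarith
  have hn' : (0 : ℝ) < n m := by exact_mod_cast hn m hkm
  refine ⟨fun d hd => ?_, fun A d hA hd => ?_⟩
  · refine hm (n m) _ (hn m hkm) measureReal_nonneg measureReal_le_one hr ?_
    rw [hTc]
    exact one_sub_errorProbGaussian_mul_log_le hk hkm hm1 hva hvz hW T hd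
  · refine hm (n m) _ (hn m hkm) measureReal_nonneg measureReal_le_one hr ?_
    rw [hTc]
    refine (one_sub_errorProbFixed_mul_log_le hk hkm hm1 hva hvz hW T A hd).trans ?_
    -- The power constraint gives `‖A‖_F² ≤ n m va`, and `n m/(m-1) - n = n/(m-1)`: the same
    -- remainder as in the Gaussian case. The sign of `τ` is needed here.
    refine add_le_add_right (mul_le_mul_of_nonneg_left ?_ hτ0) _
    have hm0 : (0 : ℝ) < m := by linarith
    rw [avgPower, div_le_iff₀ (by positivity)] at hA
    rw [sub_le_iff_le_add, div_le_iff₀ (by positivity)]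
    refine hA.trans (le_of_eq ?_)
    field_simp
    ring

end Asymptotics

end SupportRecovery

/-! ### Passage to upper and lower limits. -/

theorem theorem2 {k l : ℕ} (hk : 0 < k) (va vz : ℝ≥0) (hva : 0 < va) (hvz : 0 < vz)
    (W : Matrix (Fin k) (Fin l) ℝ) (hW : ∀ i, ∃ j, W i j ≠ 0)
    (n : ℕ → ℕ) (hn : ∀ m, k ≤ m → 0 < n m) :
    -- Gaussian measurement matrices
    (∀ d : ∀ m, Matrix (Fin (n m)) (Fin m) ℝ → Matrix (Fin (n m)) (Fin l) ℝ → Set (Fin m),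
      (∀ m, Measurable (Function.uncurry (d m))) →
        ((SupportRecovery.capacity va vz W : EReal) < limsup (SupportRecovery.rate n) atTop →
          0 < limsup (fun m => SupportRecovery.errorProbGaussian va vz W (d m)) atTop) ∧
        (∀ φ : ℕ → ℕ, StrictMono φ →
          (SupportRecovery.capacity va vz W : EReal) <
            liminf (fun j => SupportRecovery.rate n (φ j)) atTop →
          0 < liminf (fun j => SupportRecovery.errorProbGaussian va vz W (d (φ j))) atTop)) ∧
    -- arbitrary fixed measurement matrices of average power at most `va`
    (∀ (A : ∀ m, Matrix (Fin (n m)) (Fin m) ℝ)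
      (d : ∀ m, Matrix (Fin (n m)) (Fin l) ℝ → Set (Fin m)),
      (∀ m, k ≤ m → SupportRecovery.avgPower (A m) ≤ (va : ℝ)) →
      (∀ m, Measurable (d m)) →
      Tendsto (fun m => SupportRecovery.errorProbFixed vz W (A m) (d m)) atTop (𝓝 0) →
      limsup (SupportRecovery.rate n) atTop ≤ (SupportRecovery.capacity va vz W : EReal)) := by
  -- Real-valued `limsup` and `liminf` are meaningful only for bounded sequences, so these side
  -- conditions must be supplied; for the rates in `EReal` they are automatic.
  have hbdd : ∀ {u : ℕ → ℝ}, (∀ m, 0 ≤ u m) → (∀ m, u m ≤ 1) →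
      IsBoundedUnder (· ≤ ·) atTop u ∧ IsCoboundedUnder (· ≥ ·) atTop u := fun h0 h1 =>
    ⟨isBoundedUnder_of ⟨1, h1⟩, (isBoundedUnder_of ⟨1, h1⟩).isCoboundedUnder_ge⟩
  refine ⟨fun d hd => ⟨fun h => ?_, fun φ hφ h => ?_⟩, fun A d hA hd hlim => ?_⟩
  · obtain ⟨r, hr, η, hη, hev⟩ :=
      SupportRecovery.exists_pos_eventually_le_errorProb hk hva hvz hW hn h
    have hfreq := (frequently_lt_of_lt_limsup (by isBoundedDefault) hr).and_eventually hev
    refine hη.trans_le (le_limsup_of_frequently_le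
      (hfreq.mono fun m hm => (hm.2 hm.1).1 (d m) (hd m)) ?_)
    exact (hbdd (fun _ => measureReal_nonneg) fun _ => SupportRecovery.errorProbGaussian_le_one _ _).1
  · obtain ⟨r, hr, η, hη, hev⟩ :=
      SupportRecovery.exists_pos_eventually_le_errorProb hk hva hvz hW hn h
    have hlt := eventually_lt_of_lt_liminf hr (by isBoundedDefault)
    refine hη.trans_le (le_liminf_of_le ?_ ?_)
    · exact (hbdd (fun _ => measureReal_nonneg) fun _ => SupportRecovery.errorProbGaussian_le_one _ _).2
    · filter_upwards [hlt, hφ.tendsto_atTop.eventually hev] with j h1 h2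
      exact (h2 h1).1 (d (φ j)) (hd (φ j))
  · by_contra hcon
    obtain ⟨r, hr, η, hη, hev⟩ :=
      SupportRecovery.exists_pos_eventually_le_errorProb hk hva hvz hW hn (not_le.1 hcon)
    -- The rate exceeds `r` infinitely often, so some such `m` is also large enough for the error to
    -- be at once at least `η` and below `η`.
    have hfreq := (frequently_lt_of_lt_limsup (by isBoundedDefault) hr).and_eventually
      (hev.and ((eventually_ge_atTop k).and (hlim.eventually_lt_const hη)))
    obtain ⟨m, h1, h2, h3, h4⟩ := hfreq.exists
    exact absurd ((h2 h1).2 (A m) (d m) (hA m h3) (hd m)) (not_le.2 h4)
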